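/- **Games.** There are two players, the machine $\top$ and the environment $\bot$; $\neg\wp$ is the adversary of $\wp$. A move is a finite string over the (finite) keyboard alphabet, a labmove is a move labeled with a player, a run is a finite or infinite sequence of labmoves, a position is a finite run, and $\neg\Gamma$ is $\Gamma$ with all labels switched. A game $A$ consists of a set $\mathbf{Lr}^A$ of legal runs, such that a run is legal iff all its nonempty finite initial segments are, and a function $\mathbf{Wn}^A$ from runs to players, such that if the last move of the shortest illegal initial segment of $\Gamma$ is by $\wp$ ("$\Gamma$ is $\wp$-illegal"), then $\mathbf{Wn}^A\langle\Gamma\rangle=\neg\wp$. A run $\Omega$ is a $\wp$-delay of $\Gamma$ if both have the same subsequence of $\wp'$-labeled moves for each player $\wp'$, and whenever the $n$-th $\wp$-move comes later than the $k$-th $\neg\wp$-move in $\Gamma$, it does so in $\Omega$. $A$ is static if, whenever $\Omega$ is a $\wp$-delay of $\Gamma$: if $\Gamma$ is not $\wp$-illegal, neither is $\Omega$; if $\mathbf{Wn}^A\langle\Gamma\rangle=\wp$, then $\mathbf{Wn}^A\langle\Omega\rangle=\wp$. **Operations.** $\Gamma^{i.}$ is obtained from $\Gamma$ by keeping the moves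 of the form $i.\beta$ only and deleting the prefix "$i.$"; for an infinite bitstring $x$, $\Gamma^{\preceq x}$ is obtained by keeping the moves $u.\beta$ with $u$ a finite initial segment of $x$ only and deleting the prefix "$u.$". A bitstring is essentially finite if it has finitely many 1s. Winners are specified for legal runs (for illegal ones they are determined). - $\neg A$: $\Gamma$ is legal iff $\neg\Gamma\in\mathbf{Lr}^A$; $\top$ wins $\Gamma$ iff $\mathbf{Wn}^A\langle\neg\Gamma\rangle=\bot$. - $A_1\wedge A_2$, $A_1\vee A_2$: $\Gamma$ is legal iff every move is $i.\alpha$ with $i\in\{1,2\}$ and $\Gamma^{i.}\in\mathbf{Lr}^{A_i}$ for both $i$; $\top$ wins iff $\mathbf{Wn}^{A_i}\langle\Gamma^{i.}\rangle=\top$ for both $i$ (resp. for some $i$). - ${\circ}A$, ${\bullet}A$ (uncountable branching recurrence and corecurrence), and the new countable branching recurrence $\mathsf{C}_LA$ and corecurrence $\mathsf{D}_LA$: $\Gamma$ is legal iff every move is $w.\alpha$ for a finite bitstring $w$ and $\Gamma^{\preceq x}\in\mathbf{Lr}^A$ for all infinite $x$; $\top$ wins iff $\mathbf{Wn}^A\langle\Gamma^{\preceq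 x}\rangle=\top$ for all $x$ (for ${\circ}A$), for some $x$ (for ${\bullet}A$), for all essentially finite infinite $x$ (for $\mathsf{C}_LA$), for some essentially finite infinite $x$ (for $\mathsf{D}_LA$). - The old countable branching recurrence $\mathsf{C}_TA$: the nodes of a position $\Phi$ are the empty bitstring and all $u0,u1$ such that $\Phi$ contains the move "$u{:}$"; a leaf is a node that is not a proper prefix of another node. The legal moves in a legal position $\Phi$ are the moves "$w{:}$" by $\bot$ with $w$ a leaf, and the moves $w.\alpha$ by a player $\wp$ with $w$ a node such that, for every infinite extension $v$ of $w$, $\langle\Phi^{\preceq v},\wp\alpha\rangle\in\mathbf{Lr}^A$. A run is legal iff each of its moves is legal in the position in which it is made; $\top$ wins a legal $\Gamma$ iff $\mathbf{Wn}^A\langle\Gamma^{\preceq v}\rangle=\top$ for every essentially finite infinite $v$. The old corecurrence is $\mathsf{D}_TA=\neg\mathsf{C}_T\neg A$. **Formulas and machines.** Formulas are built from atoms and negated atoms with $\wedge,\vee,{\circ},{\bullet},\mathsf{C}_T,\mathsf{D}_T,\mathsf{C}_L,\mathsf{D}_L$; the negation of an arbitrary formula is defined by duality ($\neg\neg P=P$,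 and $\wedge/\vee$, ${\circ}/{\bullet}$, $\mathsf{C}_T/\mathsf{D}_T$, $\mathsf{C}_L/\mathsf{D}_L$ are interchanged), and $F\to G$ abbreviates $\neg F\vee G$. An interpretation $^*$ sends every atom to a static game, and extends to formulas through the game operations. An easy-play machine (EPM) is a deterministic Turing machine with a read/write work tape and a read-only run tape that at any time spells the current position; in a clock cycle it may make one move (spelled on its work tape) or grant permission, in which case the environment may make one move or none; the moves made are appended to the position. A computation branch is an infinite sequence of configurations, starting from the initial one with empty tapes, each a possible successor of the previous one; it is fair if permission is granted infinitely often. An EPM wins a game $A$ if every computation branch spells a run won by $\top$ and is fair unless that run is $\bot$-illegal. A formula is uniformly valid if there is one EPM that wins $F^*$ for every interpretation $^*$. **Theorem.** For every formula $F$, both $\mathsf{C}_TF\to\mathsf{C}_LF$ and $\mathsf{C}_LF\to\mathsf{C}_TF$ are uniformly valid. -/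

import Mathlib

noncomputable section

namespace CoL

/-! ### Players, moves, runs -/

/-- The two players: the machine `top` and its environment `bot`. -/
inductive Player where
  | top
  | bot
  deriving DecidableEq

instance : Fintype Player := ⟨{.top, .bot}, by rintro (_ | _) <;> simp⟩

/-- The adversary of a player. -/
def Player.neg : Player → Player
  | .top => .bot
  | .bot => .top

/-- The keyboard alphabet, with 95 symbols like the printable ASCII characters. The symbols that
play a role in the game operations are named: the digits 0, 1, 2, the period and the colon. -/
inductive Key where
  | zero
  | one
  | two
  | dot
  | colon
  | other (k : Fin 90)
  deriving DecidableEq, Fintype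

/-- A move is a finite string over the keyboard alphabet. -/
abbrev Move := List Key

/-- A labmove is a move together with the player who makes it. -/
abbrev Labmove := Player × Move

/-- A position is a finite sequence of labmoves. -/
abbrev Position := List Labmove

/-- A run is a finite or infinite sequence of labmoves; positions are coerced to runs. -/
abbrev Run := Stream'.Seq Labmove

/-- The position `Φ` is an initial segment of the run `Γ`. -/
def IsInitial (Φ : Position) (Γ : Run) : Prop := ∃ n, Γ.take n = Φ

open Classical in
/-- The limit of a sequence of positions in which each is an initial segment of the next one:
the run whose `k`-th labmove is the `k`-th labmove of any of the positions that has one. -/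
def limitRun (P : ℕ → Position) : Run :=
  ⟨fun k => if h : ∃ n, k < (P n).length then (P (Nat.find h))[k]? else none, by
    intro k hk
    have h1 : ¬ ∃ n, k < (P n).length := by
      intro h
      have hk' : (if h : ∃ n, k < (P n).length then (P (Nat.find h))[k]? else none) = none := hk
      rw [dif_pos h, List.getElem?_eq_none_iff] at hk'
      exact absurd (Nat.find_spec h) (by omega)
    have h2 : ¬ ∃ n, k + 1 < (P n).length := fun ⟨n, hn⟩ => h1 ⟨n, by omega⟩
    exact dif_neg h2⟩

/-- Apply a partial function to the labmoves of a run, deleting those on which it is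
undefined. -/
def Run.filterMap (g : Labmove → Option Labmove) (Γ : Run) : Run :=
  limitRun fun n => (Γ.take n).filterMap g

/-- The same run with every label changed to the adversary. -/
def Run.neg (Γ : Run) : Run := Γ.map fun a => (a.1.neg, a.2)

/-- Remove the prefix `p` from `m`; undefined if `p` is not a prefix of `m`. -/
def dropPre (p m : Move) : Option Move :=
  if p <+: m then some (m.drop p.length) else none

/-- `Γ^p`: keep only the moves that begin with the string `p`, and delete that prefix. -/
def Run.sub (p : Move) (Γ : Run) : Run :=
  Γ.filterMap fun a => (dropPre p a.2).map fun β => (a.1, β)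

/-! ### Bitstrings and threads -/

/-- A bit as a keyboard symbol. -/
def bitKey : Bool → Key
  | false => .zero
  | true => .one

/-- A finite bitstring as a string of keyboard symbols. -/
def bits (w : List Bool) : Move := w.map bitKey

/-- The move `w.β`. -/
def addrMove (w : List Bool) (β : Move) : Move := bits w ++ Key.dot :: β

/-- The replicative move `w:`. -/
def replMove (w : List Bool) : Move := bits w ++ [Key.colon]

/-- Read a move as `w.β` (see `parseAddr_eq_some_iff`); undefined if it is not of this form. -/
def parseAddr : Move → Option (List Bool × Move)
  | [] => none
  | .zero :: m => (parseAddr m).map fun p => (false :: p.1, p.2)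
  | .one :: m => (parseAddr m).map fun p => (true :: p.1, p.2)
  | .dot :: m => some ([], m)
  | .two :: _ => none
  | .colon :: _ => none
  | .other _ :: _ => none

theorem parseAddr_addrMove (w : List Bool) (β : Move) :
    parseAddr (addrMove w β) = some (w, β) := by
  induction w with
  | nil => rfl
  | cons b w ih =>
    cases b <;> simpa [addrMove, bits, bitKey, parseAddr] using ih

theorem parseAddr_eq_some_iff (m : Move) (w : List Bool) (β : Move) :
    parseAddr m = some (w, β) ↔ m = addrMove w β := by
  refine ⟨fun h => ?_, fun h => h ▸ parseAddr_addrMove w β⟩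
  induction m generalizing w with
  | nil => simp [parseAddr] at h
  | cons a m ih =>
    cases a with
    | zero =>
      simp only [parseAddr, Option.map_eq_some_iff] at h
      obtain ⟨⟨w', β'⟩, h1, h2⟩ := h
      cases h2
      simpa [addrMove, bits, bitKey] using ih _ h1
    | one =>
      simp only [parseAddr, Option.map_eq_some_iff] at h
      obtain ⟨⟨w', β'⟩, h1, h2⟩ := h
      cases h2
      simpa [addrMove, bits, bitKey] using ih _ h1
    | dot =>
      simp only [parseAddr, Option.some.injEq] at h
      cases h
      rfl
    | two => simp [parseAddr] at h
    | colon => simp [parseAddr] at h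
    | other k => simp [parseAddr] at h

/-- Infinite bitstrings. -/
abbrev Bitstream := ℕ → Bool

/-- `w ≼ x`: the finite bitstring `w` is an initial segment of the infinite bitstring `x`. -/
def IsPre (w : List Bool) (x : Bitstream) : Prop := ∀ i, ∀ h : i < w.length, w[i] = x i

/-- An infinite bitstring is essentially finite if it contains only finitely many 1s. -/
def EssFin (x : Bitstream) : Prop := {i | x i = true}.Finite

open Classical in
/-- The labmove `℘u.β` becomes `℘β` if `u ≼ x`; everything else is deleted. -/
def threadMap (x : Bitstream) (a : Labmove) : Option Labmove :=
  match parseAddr a.2 with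
  | some (u, β) => if IsPre u x then some (a.1, β) else none
  | none => none

/-- `Γ^{≼x}`: the run taking place in the thread `x`. -/
def Run.thread (x : Bitstream) (Γ : Run) : Run := Γ.filterMap (threadMap x)

/-! ### Games -/

/-- The last move of the shortest initial segment of `Γ` outside `L` is made by `p`. -/
def IllegalBy (L : Set Run) (p : Player) (Γ : Run) : Prop :=
  ∃ (Φ : Position) (α : Move),
    IsInitial (Φ ++ [(p, α)]) Γ ∧ (∀ Ψ, Ψ <+: Φ → (Ψ : Run) ∈ L) ∧ ((Φ ++ [(p, α)] : Position) : Run) ∉ L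

/-- A run is in `L` iff so are all of its nonempty finite initial segments. -/
def PrefixDetermined (L : Set Run) : Prop :=
  ∀ Γ : Run, Γ ∈ L ↔ ∀ Φ : Position, IsInitial Φ Γ → Φ ≠ [] → (Φ : Run) ∈ L

/-- Games: a set of legal runs and a function naming the winner of every run. -/
@[ext]
structure Game where
  Lr : Set Run
  Wn : Run → Player
  prefixDetermined : PrefixDetermined Lr
  wn_of_illegalBy : ∀ p Γ, IllegalBy Lr p Γ → Wn Γ = p.neg

/-! ### Basic facts on runs, needed to see that the game operations produce games -/

theorem take_prefix_take (Γ : Run) {m n : ℕ} (h : m ≤ n) : Γ.take m <+: Γ.take n := by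
  rw [List.prefix_iff_getElem?]
  intro i hi
  have h1 : (Γ.take m)[i]? = some (Γ.take m)[i] := List.getElem?_eq_getElem hi
  rw [← h1, Stream'.Seq.getElem?_take, Stream'.Seq.getElem?_take]
  have : i < m := lt_of_lt_of_le hi Stream'.Seq.length_take_le
  rw [if_pos this, if_pos (by omega)]

theorem take_ofList (Φ : Position) (n : ℕ) : (Φ : Run).take n = Φ.take n := by
  apply List.ext_getElem?
  intro i
  rw [Stream'.Seq.getElem?_take, List.getElem?_take]
  simp

theorem isInitial_ofList (Φ Ψ : Position) : IsInitial Φ (Ψ : Run) ↔ Φ <+: Ψ := by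
  constructor
  · rintro ⟨n, rfl⟩
    rw [take_ofList]
    exact List.take_prefix _ _
  · intro h
    exact ⟨Φ.length, by rw [take_ofList, ← List.prefix_iff_eq_take.1 h]⟩

theorem IsInitial.get? {Φ : Position} {Γ : Run} (h : IsInitial Φ Γ) {i : ℕ}
    (hi : i < Φ.length) : Γ.get? i = Φ[i]? := by
  obtain ⟨n, rfl⟩ := h
  have : i < n := lt_of_lt_of_le hi Stream'.Seq.length_take_le
  rw [Stream'.Seq.getElem?_take, if_pos this]

theorem isInitial_iff {Φ : Position} {Γ : Run} :
    IsInitial Φ Γ ↔ ∀ i < Φ.length, Γ.get? i = Φ[i]? := by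
  refine ⟨fun h i hi => h.get? hi, fun h => ⟨Φ.length, ?_⟩⟩
  apply List.ext_getElem?
  intro i
  rw [Stream'.Seq.getElem?_take]
  split_ifs with hi
  · exact h i hi
  · exact (List.getElem?_eq_none (by omega)).symm

theorem IsInitial.trans {Φ Ψ : Position} {Γ : Run} (h : Φ <+: Ψ) (h' : IsInitial Ψ Γ) :
    IsInitial Φ Γ := by
  rw [isInitial_iff]
  intro i hi
  rw [h'.get? (lt_of_lt_of_le hi h.length_le), List.prefix_iff_getElem?.1 h i hi,
    List.getElem?_eq_getElem hi]

theorem isInitial_take (Γ : Run) (n : ℕ) : IsInitial (Γ.take n) Γ := ⟨n, rfl⟩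

theorem IsInitial.prefix_total {Φ Ψ : Position} {Γ : Run} (h : IsInitial Φ Γ)
    (h' : IsInitial Ψ Γ) : Φ <+: Ψ ∨ Ψ <+: Φ := by
  obtain ⟨m, rfl⟩ := h
  obtain ⟨n, rfl⟩ := h'
  rcases le_total m n with h | h
  · exact Or.inl (take_prefix_take Γ h)
  · exact Or.inr (take_prefix_take Γ h)

theorem limitRun_get? {P : ℕ → Position} (hP : ∀ m n, m ≤ n → P m <+: P n) {n k : ℕ}
    (hk : k < (P n).length) : (limitRun P).get? k = (P n)[k]? := by
  classical
  have h : ∃ n, k < (P n).length := ⟨n, hk⟩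
  have h1 : (limitRun P).get? k = (P (Nat.find h))[k]? := dif_pos h
  have h2 : k < (P (Nat.find h)).length := Nat.find_spec h
  have h3 := hP _ _ (Nat.find_min' h hk)
  rw [h1, List.prefix_iff_getElem?.1 h3 k h2, List.getElem?_eq_getElem h2]

theorem limitRun_get?_none {P : ℕ → Position} {k : ℕ} (hk : ∀ n, (P n).length ≤ k) :
    (limitRun P).get? k = none :=
  dif_neg fun ⟨n, hn⟩ => absurd (hk n) (by omega)

theorem isInitial_limitRun {P : ℕ → Position} (hP : ∀ m n, m ≤ n → P m <+: P n) (n : ℕ) :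
    IsInitial (P n) (limitRun P) :=
  isInitial_iff.2 fun _ hi => limitRun_get? hP hi

theorem prefix_of_isInitial_limitRun {P : ℕ → Position} (hP : ∀ m n, m ≤ n → P m <+: P n)
    {Φ : Position} (h : IsInitial Φ (limitRun P)) : ∃ n, Φ <+: P n := by
  rcases Nat.eq_zero_or_pos Φ.length with h0 | h0
  · exact ⟨0, by rw [List.length_eq_zero_iff.1 h0]; exact List.nil_prefix⟩
  · by_cases hn : ∃ n, Φ.length ≤ (P n).length
    · obtain ⟨n, hn⟩ := hn
      refine ⟨n, ?_⟩
      rcases h.prefix_total (isInitial_limitRun hP n) with h' | h'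
      · exact h'
      · exact (h'.eq_of_length_le hn) ▸ List.prefix_rfl
    · exfalso
      push Not at hn
      have h1 := h.get? (i := Φ.length - 1) (by omega)
      rw [limitRun_get?_none (fun n => by have := hn n; omega)] at h1
      have := List.getElem?_eq_none_iff.1 h1.symm
      omega

theorem filterMap_take_mono (g : Labmove → Option Labmove) (Γ : Run) (m n : ℕ) (h : m ≤ n) :
    (Γ.take m).filterMap g <+: (Γ.take n).filterMap g :=
  (take_prefix_take Γ h).filterMap g

theorem Run.filterMap_ofList (g : Labmove → Option Labmove) (Φ : Position) :
    Run.filterMap g (Φ : Run) = ((Φ.filterMap g : Position) : Run) := by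
  have hP := filterMap_take_mono g (Φ : Run)
  have hfull : ∀ n, Φ.length ≤ n → (Φ : Run).take n = Φ := fun n hn => by
    rw [take_ofList, List.take_of_length_le hn]
  apply Stream'.Seq.ext
  intro k
  rw [Stream'.Seq.ofList_get?]
  by_cases hk : k < (Φ.filterMap g).length
  · have h := limitRun_get? hP (n := Φ.length) (k := k) (by rw [hfull _ le_rfl]; exact hk)
    rw [hfull _ le_rfl] at h
    exact h
  · rw [List.getElem?_eq_none (by omega)]
    apply limitRun_get?_none
    intro n
    have h := (hP n (max n Φ.length) (le_max_left _ _)).length_le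
    rw [hfull _ (le_max_right _ _)] at h
    omega

theorem PrefixDetermined.of_prefix {L : Set Run} (hL : PrefixDetermined L) {Φ Ψ : Position}
    (h : Φ <+: Ψ) (hΨ : (Ψ : Run) ∈ L) : (Φ : Run) ∈ L :=
  (hL _).2 fun Θ hΘ hne =>
    (hL _).1 hΨ Θ ((isInitial_ofList _ _).2 (((isInitial_ofList _ _).1 hΘ).trans h)) hne

theorem PrefixDetermined.nil_mem {L : Set Run} (hL : PrefixDetermined L) :
    (([] : Position) : Run) ∈ L :=
  (hL _).2 fun _ h hne => absurd (List.prefix_nil.1 ((isInitial_ofList _ _).1 h)) hne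

theorem PrefixDetermined.inter {ι : Sort*} {L : ι → Set Run}
    (hL : ∀ i, PrefixDetermined (L i)) : PrefixDetermined {Γ | ∀ i, Γ ∈ L i} := fun Γ =>
  ⟨fun h Φ h1 h2 i => (hL i Γ).1 (h i) Φ h1 h2, fun h i => (hL i Γ).2 fun Φ h1 h2 => h Φ h1 h2 i⟩

theorem PrefixDetermined.and {L L' : Set Run} (hL : PrefixDetermined L)
    (hL' : PrefixDetermined L') : PrefixDetermined {Γ | Γ ∈ L ∧ Γ ∈ L'} := fun Γ =>
  ⟨fun h Φ h1 h2 => ⟨(hL Γ).1 h.1 Φ h1 h2, (hL' Γ).1 h.2 Φ h1 h2⟩,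
    fun h => ⟨(hL Γ).2 fun Φ h1 h2 => (h Φ h1 h2).1, (hL' Γ).2 fun Φ h1 h2 => (h Φ h1 h2).2⟩⟩

theorem prefixDetermined_forall_moves (p : Move → Prop) :
    PrefixDetermined {Γ | ∀ a ∈ Γ, p a.2} := by
  intro Γ
  simp only [Set.mem_ofPred_eq, Stream'.Seq.mem_iff_exists_get?]
  constructor
  · rintro h Φ hΦ - a ⟨i, hi⟩
    rw [Stream'.Seq.ofList_get?] at hi
    have hlt : i < Φ.length := by
      by_contra hc
      rw [List.getElem?_eq_none (by omega)] at hi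
      exact absurd hi (by simp)
    exact h a ⟨i, by rw [hΦ.get? hlt, ← hi]⟩
  · rintro h a ⟨i, hi⟩
    have hi' : (Γ.take (i + 1))[i]? = some a := by
      rw [Stream'.Seq.getElem?_take, if_pos (by omega), ← hi]
    refine h _ (isInitial_take Γ (i + 1)) ?_ a ⟨i, ?_⟩
    · intro hc
      rw [hc] at hi'
      simp at hi'
    · rw [Stream'.Seq.ofList_get?, hi']

theorem PrefixDetermined.filterMap {L : Set Run} (hL : PrefixDetermined L)
    (g : Labmove → Option Labmove) : PrefixDetermined {Γ | Run.filterMap g Γ ∈ L} := by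
  intro Γ
  have hP := filterMap_take_mono g Γ
  simp only [Set.mem_ofPred_eq, Run.filterMap_ofList]
  constructor
  · rintro h Φ ⟨n, rfl⟩ -
    by_cases h0 : (Γ.take n).filterMap g = []
    · rw [h0]
      exact hL.nil_mem
    · exact (hL _).1 h _ (isInitial_limitRun hP n) h0
  · intro h
    refine (hL _).2 fun Ψ hΨ _ => ?_
    obtain ⟨n, hn⟩ := prefix_of_isInitial_limitRun hP hΨ
    refine hL.of_prefix hn ?_
    by_cases h0 : Γ.take n = []
    · rw [h0]
      exact hL.nil_mem
    · exact h _ (isInitial_take Γ n) h0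

/-- A set of runs given by a condition on every single move in the position where it is made. -/
theorem prefixDetermined_forall_steps (q : Position → Labmove → Prop) :
    PrefixDetermined {Γ | ∀ Φ a, IsInitial (Φ ++ [a]) Γ → q Φ a} := by
  intro Γ
  constructor
  · intro h Ψ hΨ _ Φ a ha
    exact h Φ a (IsInitial.trans ((isInitial_ofList _ _).1 ha) hΨ)
  · intro h Φ a ha
    exact h _ ha (by simp) Φ a ((isInitial_ofList _ _).2 List.prefix_rfl)

theorem IllegalBy.not_mem {L : Set Run} (hL : PrefixDetermined L) {p : Player} {Γ : Run}
    (h : IllegalBy L p Γ) : Γ ∉ L := by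
  obtain ⟨Φ, α, h1, -, h3⟩ := h
  exact fun hΓ => h3 ((hL Γ).1 hΓ _ h1 (by simp))

theorem IllegalBy.unique {L : Set Run} {p q : Player} {Γ : Run}
    (h : IllegalBy L p Γ) (h' : IllegalBy L q Γ) : p = q := by
  obtain ⟨Φ, α, h1, h2, h3⟩ := h
  obtain ⟨Ψ, β, h1', h2', h3'⟩ := h'
  have key : ∀ {Φ Ψ : Position} {a b : Labmove}, Φ ++ [a] <+: Ψ ++ [b] →
      ((Φ ++ [a] : Position) : Run) ∉ L → (∀ Θ, Θ <+: Ψ → (Θ : Run) ∈ L) → a = b := by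
    intro Φ Ψ a b hp hn hl
    rcases List.prefix_concat_iff.1 hp with h | h
    · exact (List.append_inj' h rfl).2 |> fun h => by simpa using h
    · exact absurd (hl _ h) hn
  rcases h1.prefix_total h1' with h | h
  · exact congrArg Prod.fst (key h h3 h2')
  · exact (congrArg Prod.fst (key h h3' h2)).symm

/-! ### Game operations -/

open Classical in
/-- The game with the set `L` of legal runs in which a legal run is won by the machine iff `W`
holds of it; an illegal run is lost by the player who made it illegal. -/
def Game.ofLegal (L : Set Run) (hL : PrefixDetermined L) (W : Run → Prop) : Game where
  Lr := L
  Wn Γ :=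
    if Γ ∈ L then (if W Γ then .top else .bot)
    else if IllegalBy L .bot Γ then .top else .bot
  prefixDetermined := hL
  wn_of_illegalBy p Γ h := by
    rw [if_neg (h.not_mem hL)]
    cases p with
    | bot => rw [if_pos h]; rfl
    | top =>
      rw [if_neg fun h' => absurd (h.unique h') (by decide)]
      rfl

theorem Player.neg_neg (p : Player) : p.neg.neg = p := by cases p <;> rfl

theorem Run.neg_neg (Γ : Run) : Γ.neg.neg = Γ := by
  apply Stream'.Seq.ext
  intro n
  simp only [Run.neg, Stream'.Seq.map_get?, Option.map_map]
  cases Γ.get? n <;> simp [Player.neg_neg]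

/-- Negation on positions. -/
def Position.neg (Φ : Position) : Position := Φ.map fun a => (a.1.neg, a.2)

theorem Run.neg_ofList (Φ : Position) : Run.neg (Φ : Run) = ((Position.neg Φ : Position) : Run) := by
  apply Stream'.Seq.ext
  intro n
  simp [Run.neg, Position.neg]

theorem Position.neg_neg (Φ : Position) : Position.neg (Position.neg Φ) = Φ := by
  simp [Position.neg, Function.comp_def, Player.neg_neg]

theorem IsInitial.neg {Φ : Position} {Γ : Run} (h : IsInitial Φ Γ) :
    IsInitial (Position.neg Φ) Γ.neg := by
  rw [isInitial_iff]
  intro i hi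
  rw [Position.neg, List.length_map] at hi
  simp [Run.neg, Position.neg, h.get? hi]

theorem PrefixDetermined.neg {L : Set Run} (hL : PrefixDetermined L) :
    PrefixDetermined {Γ | Γ.neg ∈ L} := by
  intro Γ
  simp only [Set.mem_ofPred_eq, Run.neg_ofList]
  constructor
  · intro h Φ h1 h2
    exact (hL _).1 h _ h1.neg (by simpa [Position.neg] using h2)
  · intro h
    refine (hL _).2 fun Ψ h1 h2 => ?_
    have h3 := h (Position.neg Ψ) (by simpa only [Run.neg_neg] using h1.neg)
      (by simpa [Position.neg] using h2)
    rwa [Position.neg_neg] at h3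

theorem IllegalBy.neg {L : Set Run} {p : Player} {Γ : Run}
    (h : IllegalBy {Γ | Γ.neg ∈ L} p Γ) : IllegalBy L p.neg Γ.neg := by
  obtain ⟨Φ, α, h1, h2, h3⟩ := h
  have e : Position.neg Φ ++ [(p.neg, α)] = Position.neg (Φ ++ [(p, α)]) := by simp [Position.neg]
  refine ⟨Position.neg Φ, α, ?_, ?_, ?_⟩
  · rw [e]
    exact h1.neg
  · intro Ψ hΨ
    have h4 : Position.neg Ψ <+: Φ := by
      have h5 := hΨ.map fun a : Labmove => (a.1.neg, a.2)
      have h6 : Position.neg Ψ <+: Position.neg (Position.neg Φ) := h5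
      rwa [Position.neg_neg] at h6
    have h7 : Run.neg ((Position.neg Ψ : Position) : Run) ∈ L := h2 _ h4
    rwa [Run.neg_ofList, Position.neg_neg] at h7
  · rw [e, ← Run.neg_ofList]
    exact h3

/-- Negation. -/
def Game.neg (A : Game) : Game where
  Lr := {Γ | Γ.neg ∈ A.Lr}
  Wn Γ := (A.Wn Γ.neg).neg
  prefixDetermined := A.prefixDetermined.neg
  wn_of_illegalBy p Γ h := by
    rw [A.wn_of_illegalBy _ _ h.neg, Player.neg_neg]

/-- The prefix `1.` or `2.` of the moves in the left or right component. -/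
def compPre : Bool → Move
  | false => [.one, .dot]
  | true => [.two, .dot]

/-- The legal runs of a parallel combination: every move is `i.α` for some `i ∈ {1, 2}`, and the
moves in either component form a legal run of it. -/
def parLr (A : Bool → Game) : Set Run :=
  {Γ | (∀ a ∈ Γ, ∃ i α, a.2 = compPre i ++ α) ∧ ∀ i, Γ.sub (compPre i) ∈ (A i).Lr}

theorem parLr_prefixDetermined (A : Bool → Game) : PrefixDetermined (parLr A) :=
  (prefixDetermined_forall_moves fun m => ∃ i α, m = compPre i ++ α).and
    (PrefixDetermined.inter fun i => (A i).prefixDetermined.filterMap _)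

/-- Parallel conjunction. -/
def Game.and (A B : Game) : Game :=
  Game.ofLegal (parLr fun i => if i then B else A) (parLr_prefixDetermined _) fun Γ =>
    A.Wn (Γ.sub (compPre false)) = .top ∧ B.Wn (Γ.sub (compPre true)) = .top

/-- Parallel disjunction. -/
def Game.or (A B : Game) : Game :=
  Game.ofLegal (parLr fun i => if i then B else A) (parLr_prefixDetermined _) fun Γ =>
    A.Wn (Γ.sub (compPre false)) = .top ∨ B.Wn (Γ.sub (compPre true)) = .top

/-- The legal runs of the simplified branching (co)recurrences: every move is `w.α` for some
finite bitstring `w`, and every thread is a legal run of `A`. -/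
def branchLr (A : Game) : Set Run :=
  {Γ | (∀ a ∈ Γ, ∃ w α, a.2 = addrMove w α) ∧ ∀ x : Bitstream, Γ.thread x ∈ A.Lr}

theorem branchLr_prefixDetermined (A : Game) : PrefixDetermined (branchLr A) :=
  (prefixDetermined_forall_moves fun m => ∃ w α, m = addrMove w α).and
    (PrefixDetermined.inter fun _ => A.prefixDetermined.filterMap _)

/-- Uncountable branching recurrence. -/
def Game.st (A : Game) : Game :=
  Game.ofLegal (branchLr A) (branchLr_prefixDetermined A) fun Γ =>
    ∀ x : Bitstream, A.Wn (Γ.thread x) = .top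

/-- Uncountable branching corecurrence. -/
def Game.cost (A : Game) : Game :=
  Game.ofLegal (branchLr A) (branchLr_prefixDetermined A) fun Γ =>
    ∃ x : Bitstream, A.Wn (Γ.thread x) = .top

/-- The new version of countable branching recurrence. -/
def Game.cstL (A : Game) : Game :=
  Game.ofLegal (branchLr A) (branchLr_prefixDetermined A) fun Γ =>
    ∀ v : Bitstream, EssFin v → A.Wn (Γ.thread v) = .top

/-- The new version of countable branching corecurrence. -/
def Game.ccostL (A : Game) : Game :=
  Game.ofLegal (branchLr A) (branchLr_prefixDetermined A) fun Γ =>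
    ∃ v : Bitstream, EssFin v ∧ A.Wn (Γ.thread v) = .top

/-- `w` is a node of the underlying BT-structure of the position `Φ`: it is empty, or it is `u0`
or `u1` for some `u` such that `Φ` contains the move `u:`. -/
def IsNode (Φ : Position) (w : List Bool) : Prop :=
  w = [] ∨ ∃ (u : List Bool) (b : Bool), w = u ++ [b] ∧ ∃ a ∈ Φ, a.2 = replMove u

/-- A leaf is a node that is not a proper prefix of any other node. -/
def IsLeaf (Φ : Position) (w : List Bool) : Prop :=
  IsNode Φ w ∧ ∀ w', IsNode Φ w' → w <+: w' → w' = w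

/-- The labmove `a` is legal in the position `Φ` of the old countable branching recurrence:
either it is a replicative move `w:` by the environment, where `w` is a leaf, or it is a move
`w.α` by either player, where `w` is a node and `α` is a legal move of that player in all the
threads that extend `w`. -/
def OldLegalMove (A : Game) (Φ : Position) (a : Labmove) : Prop :=
  (a.1 = .bot ∧ ∃ w, IsLeaf Φ w ∧ a.2 = replMove w) ∨
    ∃ w α, a.2 = addrMove w α ∧ IsNode Φ w ∧
      ∀ v : Bitstream, IsPre w v →
        ((Φ.filterMap (threadMap v) ++ [(a.1, α)] : Position) : Run) ∈ A.Lr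

/-- The old version of countable branching recurrence. -/
def Game.cstT (A : Game) : Game :=
  Game.ofLegal {Γ | ∀ Φ a, IsInitial (Φ ++ [a]) Γ → OldLegalMove A Φ a}
    (prefixDetermined_forall_steps _) fun Γ =>
      ∀ v : Bitstream, EssFin v → A.Wn (Γ.thread v) = .top

/-- The old version of countable branching corecurrence. -/
def Game.ccostT (A : Game) : Game := A.neg.cstT.neg

/-! ### Static games -/

/-- The labmove number `i` (counting from 0) of `Γ` is the `n`-th (counting from 1) labmove of the
player `p` in it. -/
def IsNthOf (Γ : Run) (p : Player) (n i : ℕ) : Prop :=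
  (∃ α, Γ.get? i = some (p, α)) ∧ ((Γ.take (i + 1)).filter fun a => a.1 = p).length = n

/-- In `Γ`, the `n`-th move of `p` is made later than the `k`-th move of the adversary. -/
def Later (Γ : Run) (p : Player) (n k : ℕ) : Prop :=
  ∃ i j, IsNthOf Γ p n i ∧ IsNthOf Γ p.neg k j ∧ j < i

/-- The subsequence of the labmoves of the player `q`. -/
def Run.movesOf (q : Player) (Γ : Run) : Run :=
  Γ.filterMap fun a => if a.1 = q then some a else none

/-- `Ω` is a `p`-delay of `Γ`. -/
def IsDelay (p : Player) (Ω Γ : Run) : Prop :=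
  (∀ q, Ω.movesOf q = Γ.movesOf q) ∧ ∀ n k, 1 ≤ n → 1 ≤ k → Later Γ p n k → Later Ω p n k

/-- Static games. -/
def Game.Static (A : Game) : Prop :=
  ∀ (p : Player) (Ω Γ : Run), IsDelay p Ω Γ →
    (¬ IllegalBy A.Lr p Γ → ¬ IllegalBy A.Lr p Ω) ∧ (A.Wn Γ = p → A.Wn Ω = p)

/-! ### Easy-play machines -/

/-- The symbols on the run tape: the labels of the players, and the keyboard symbols. -/
inductive RunSym where
  | label (p : Player)
  | key (c : Key)
  deriving DecidableEq, Fintype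

/-- The string that spells a position on the run tape: every move is preceded by its label. -/
def spell (Φ : Position) : List RunSym :=
  Φ.flatMap fun a => RunSym.label a.1 :: a.2.map RunSym.key

/-- What a machine can do in one clock cycle: write a symbol in the scanned cell of the work
tape, move the head of the work tape or of the run tape by one cell, make the move that is
spelled on the work tape, or grant permission to the environment. -/
inductive Instr (W : Type) where
  | write (a : W)
  | moveWork (d : Turing.Dir)
  | moveRun (d : Turing.Dir)
  | makeMove
  | grant

/-- An easy-play machine: a deterministic Turing machine with a read/write work tape and a
read-only run tape. The blank of the work tape is the default symbol. Some nonblank work tape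
symbols stand for keyboard symbols, as told by `key`. The transition function depends on the
state and the symbols scanned on the work tape and on the run tape (`none` is a blank). -/
structure EPM where
  State : Type
  Work : Type
  [finState : Finite State]
  [finWork : Finite Work]
  [blank : Inhabited Work]
  key : Work → Option Key
  key_blank : key default = none
  start : State
  trans : State → Work → Option RunSym → State × Instr Work

attribute [instance] EPM.finState EPM.finWork EPM.blank

namespace EPM

/-- A configuration: the state, the work tape with its head, the position spelled on the run
tape, and the location of the head of the run tape (the spelling starts in the cell 0). -/
structure Cfg (M : EPM) where
  state : M.State
  work : Turing.Tape M.Work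
  pos : Position
  runHead : ℤ

/-- The initial configuration: start state and empty tapes. -/
def init (M : EPM) : M.Cfg := ⟨M.start, default, [], 0⟩

/-- The symbol scanned on the run tape; `none` is a blank. -/
def Cfg.scanned {M : EPM} (C : M.Cfg) : Option RunSym :=
  if 0 ≤ C.runHead then (spell C.pos)[C.runHead.toNat]? else none

/-- The next state and the current instruction. -/
def Cfg.instr {M : EPM} (C : M.Cfg) : M.State × Instr M.Work :=
  M.trans C.state C.work.head C.scanned

/-- The keyboard symbols at the beginning of a string of work tape symbols. -/
def leading (M : EPM) : List M.Work → Move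
  | [] => []
  | a :: l => match M.key a with
    | some c => c :: leading M l
    | none => []

theorem leading_append_blank (M : EPM) (l : List M.Work) (n : ℕ) :
    M.leading (l ++ List.replicate n default) = M.leading l := by
  induction l with
  | nil => cases n <;> simp [leading, List.replicate_succ, M.key_blank]
  | cons a l ih =>
    simp only [List.cons_append, leading]
    cases M.key a <;> simp [ih]

/-- The move spelled on the work tape: the longest string of keyboard symbols that begins in the
scanned cell and extends to the right. -/
def spelledMove (M : EPM) (T : Turing.Tape M.Work) : Move :=
  T.right₀.liftOn M.leading fun a b h => by
    obtain ⟨n, rfl⟩ := h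
    exact (M.leading_append_blank a n).symm

/-- A move of a head on a two-way infinite tape. -/
def shift (h : ℤ) : Turing.Dir → ℤ
  | .left => h - 1
  | .right => h + 1

/-- The next configuration, where `e` is what the environment does if permission is granted:
make one move or none. -/
def Cfg.next {M : EPM} (C : M.Cfg) (e : Option Move) : M.Cfg :=
  match C.instr with
  | (q, .write a) => { C with state := q, work := C.work.write a }
  | (q, .moveWork d) => { C with state := q, work := C.work.move d }
  | (q, .moveRun d) => { C with state := q, runHead := shift C.runHead d }
  | (q, .makeMove) => { C with state := q, pos := C.pos ++ [(.top, M.spelledMove C.work)] }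
  | (q, .grant) => { C with
      state := q
      pos := C.pos ++ e.toList.map fun α => (Player.bot, α) }

/-- A computation branch. -/
def IsBranch (M : EPM) (B : ℕ → M.Cfg) : Prop :=
  B 0 = M.init ∧ ∀ n, ∃ e : Option Move, B (n + 1) = (B n).next e

/-- A branch is fair if permission is granted infinitely many times in it. -/
def Fair (M : EPM) (B : ℕ → M.Cfg) : Prop :=
  ∀ N, ∃ n ≥ N, (B n).instr.2 = .grant

/-- The run spelled by a branch. -/
def runOf (M : EPM) (B : ℕ → M.Cfg) : Run := limitRun fun n => (B n).pos

/-- The machine wins the game: the run spelled by any branch is won by the machine, and the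
branch is fair unless the environment made the run illegal. -/
def Wins (M : EPM) (A : Game) : Prop :=
  ∀ B, M.IsBranch B →
    A.Wn (M.runOf B) = .top ∧ (M.Fair B ∨ IllegalBy A.Lr .bot (M.runOf B))

end EPM

/-! ### Formulas -/

/-- Formulas over a set of atoms, with negation applied to atoms only. Both versions of countable
branching recurrence and corecurrence may occur. -/
inductive Formula (Atom : Type*) where
  | atom (P : Atom)
  | natom (P : Atom)
  | and (F G : Formula Atom)
  | or (F G : Formula Atom)
  | st (F : Formula Atom)
  | cost (F : Formula Atom)
  | cstT (F : Formula Atom)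
  | ccostT (F : Formula Atom)
  | cstL (F : Formula Atom)
  | ccostL (F : Formula Atom)

namespace Formula

universe u

variable {Atom : Type u}

/-- The negation of a formula, an abbreviation defined by duality. -/
def neg : Formula Atom → Formula Atom
  | atom P => natom P
  | natom P => atom P
  | and F G => or F.neg G.neg
  | or F G => and F.neg G.neg
  | st F => cost F.neg
  | cost F => st F.neg
  | cstT F => ccostT F.neg
  | ccostT F => cstT F.neg
  | cstL F => ccostL F.neg
  | ccostL F => cstL F.neg

/-- `F → G` abbreviates `¬F ∨ G`. -/
def imp (F G : Formula Atom) : Formula Atom := or F.neg G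

/-- The game that interprets a formula, given the games that interpret the atoms. -/
def interp (I : Atom → Game) : Formula Atom → Game
  | atom P => I P
  | natom P => (I P).neg
  | and F G => (F.interp I).and (G.interp I)
  | or F G => (F.interp I).or (G.interp I)
  | st F => (F.interp I).st
  | cost F => (F.interp I).cost
  | cstT F => (F.interp I).cstT
  | ccostT F => (F.interp I).ccostT
  | cstL F => (F.interp I).cstL
  | ccostL F => (F.interp I).ccostL

/-- A formula is uniformly valid if a single machine wins it under every interpretation of the
atoms as static games. -/
def UniformlyValid (F : Formula Atom) : Prop :=
  ∃ M : EPM, ∀ I : Atom → Game, (∀ P, (I P).Static) → M.Wins (F.interp I)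

end Formula

end CoL

end

/-!
Both implications are won by copycat strategies: the machine copies each move of the environment
to the other component, so that every bitstring `y` of the consequent is matched with a bitstring
`x` of the antecedent along which the two components show the same play, up to delays.

Against the new recurrence in the consequent, one takes `x = y`: before answering a move made at an
address `w`, the machine grows the tree of the antecedent until it is complete to a depth exceeding
the length of `w`, so that every address in use is a node, and moves are copied verbatim.

Against the old recurrence in the consequent, the machine keeps a table matching every leaf of its
tree with an address in the antecedent. Before answering a move made in the antecedent, it appends
zeros to all these addresses until none of them is a proper prefix of the address of that move. An
address has exactly as many ones as its leaf, so an essentially finite branch is matched with an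
essentially finite thread.

Both strategies are computable functions of the position, and a computable strategy is carried out
by an easy-play machine because partial recursive functions are computed by Turing machines.
-/

noncomputable section

namespace CoL

/-! ### Machines as agents -/

section

theorem limitRun_comp_strictMono {P : ℕ → Position} (hP : ∀ m n, m ≤ n → P m <+: P n) {t : ℕ → ℕ}
    (ht : StrictMono t) : limitRun (P ∘ t) = limitRun P := by
  refine Stream'.Seq.ext fun k => ?_
  by_cases h : ∃ n, k < (P n).length
  · obtain ⟨n, hn⟩ := h
    have hk : k < (P (t n)).length := hn.trans_le (hP _ _ (ht.le_apply)).length_le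
    rw [limitRun_get? hP hk]
    exact limitRun_get? (P := P ∘ t) (fun i j h => hP _ _ (ht.monotone h)) hk
  · simp only [not_exists, not_lt] at h
    exact (limitRun_get?_none (P := P ∘ t) fun n => h (t n)).trans (limitRun_get?_none h).symm

/-- An agent that plays a game: a deterministic system whose configurations carry a position, and
which reads a move of the environment whenever it grants permission. Easy-play machines, and the
more convenient devices that they simulate, are agents. -/
structure Agent where
  Cfg : Type
  init : Cfg
  pos : Cfg → Position
  grants : Cfg → Prop
  next : Cfg → Option Move → Cfg
  next_of_not_grants {C : Cfg} (h : ¬ grants C) (e : Option Move) : next C e = next C none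
  pos_prefix_next (C : Cfg) (e : Option Move) : pos C <+: pos (next C e)

namespace Agent

variable {M N : Agent}

/-- A branch of the behaviour of an agent. -/
def IsBranch (M : Agent) (B : ℕ → M.Cfg) : Prop :=
  B 0 = M.init ∧ ∀ n, ∃ e : Option Move, B (n + 1) = M.next (B n) e

/-- An agent wins a game if it wins along every branch, and grants permission infinitely often
unless the environment made the run illegal. -/
def Wins (M : Agent) (A : Game) : Prop :=
  ∀ B, M.IsBranch B → A.Wn (limitRun fun n => M.pos (B n)) = .top ∧
    ((∀ n, ∃ m ≥ n, M.grants (B m)) ∨ IllegalBy A.Lr .bot (limitRun fun n => M.pos (B n)))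

/-- A segment of the behaviour of an agent in which it does not grant permission. -/
def Reaches (M : Agent) : M.Cfg → M.Cfg → Prop :=
  Relation.ReflTransGen fun C C' => ¬ M.grants C ∧ C' = M.next C none

theorem IsBranch.pos_prefix {B : ℕ → M.Cfg} (hB : M.IsBranch B) (m n : ℕ) (h : m ≤ n) :
    M.pos (B m) <+: M.pos (B n) := by
  induction n, h using Nat.le_induction with
  | base => exact List.prefix_rfl
  | succ n _ ih =>
    obtain ⟨e, he⟩ := hB.2 n
    rw [he]
    exact ih.trans (M.pos_prefix_next _ e)

theorem IsBranch.exists_of_reaches {B : ℕ → M.Cfg} (hB : M.IsBranch B) {C : M.Cfg} {n : ℕ}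
    (h : M.Reaches (B n) C) : ∃ m ≥ n, B m = C := by
  induction h with
  | refl => exact ⟨n, le_rfl, rfl⟩
  | tail _ h ih =>
    obtain ⟨m, hm, rfl⟩ := ih
    obtain ⟨e, he⟩ := hB.2 m
    exact ⟨m + 1, by omega, by rw [he, M.next_of_not_grants h.1, h.2]⟩

/-- A simulation of `N` by `M`, in which a step of `N` may take `M` any number of steps before and
after the one in which permission is granted. -/
structure Simulates (M N : Agent) (Rep : M.Cfg → N.Cfg → Prop) : Prop where
  init : ∃ C, M.Reaches M.init C ∧ Rep C N.init
  pos {C C'} : Rep C C' → M.pos C = N.pos C'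
  step {C C'} : Rep C C' → ∃ C₁, M.Reaches C C₁ ∧ (N.grants C' → M.grants C₁) ∧
    ∀ e, ∃ C₂, M.Reaches (M.next C₁ e) C₂ ∧ Rep C₂ (N.next C' e)

theorem Simulates.exists_branch {Rep : M.Cfg → N.Cfg → Prop} (h : M.Simulates N Rep)
    {B : ℕ → M.Cfg} (hB : M.IsBranch B) :
    ∃ B', N.IsBranch B' ∧ ∃ t : ℕ → ℕ, StrictMono t ∧ ∀ n, Rep (B (t n)) (B' n) := by
  have hstep : ∀ x : {x : ℕ × N.Cfg // Rep (B x.1) x.2}, ∃ y : {x : ℕ × N.Cfg // Rep (B x.1) x.2},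
      x.1.1 < y.1.1 ∧ ∃ e, y.1.2 = N.next x.1.2 e := by
    rintro ⟨⟨n, C'⟩, hC⟩
    obtain ⟨C₁, h₁, -, h₂⟩ := h.step hC
    obtain ⟨m, hm, rfl⟩ := hB.exists_of_reaches h₁
    obtain ⟨e, he⟩ := hB.2 m
    obtain ⟨C₂, h₃, hC₂⟩ := h₂ e
    obtain ⟨k, hk, rfl⟩ := hB.exists_of_reaches (he ▸ h₃)
    exact ⟨⟨⟨k, _⟩, hC₂⟩, Nat.lt_of_lt_of_le (Nat.lt_succ_of_le hm) hk, e, rfl⟩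
  obtain ⟨C, h₀, hC⟩ := h.init
  obtain ⟨k, -, rfl⟩ := hB.exists_of_reaches (hB.1 ▸ h₀)
  choose f hf using hstep
  let x : ℕ → {x : ℕ × N.Cfg // Rep (B x.1) x.2} := fun n => f^[n] ⟨(k, N.init), hC⟩
  have hx : ∀ n, x (n + 1) = f (x n) := fun n => Function.iterate_succ_apply' f n _
  refine ⟨fun n => (x n).1.2, ⟨rfl, fun n => ?_⟩, fun n => (x n).1.1,
    strictMono_nat_of_lt_succ fun n => ?_, fun n => (x n).2⟩
  · simpa only [hx] using (hf (x n)).2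
  · simpa only [hx] using (hf (x n)).1

theorem Simulates.wins {Rep : M.Cfg → N.Cfg → Prop} (h : M.Simulates N Rep) {A : Game}
    (hA : N.Wins A) : M.Wins A := by
  intro B hB
  obtain ⟨B', hB', t, ht, hr⟩ := h.exists_branch hB
  have hrun : limitRun (fun n => N.pos (B' n)) = limitRun fun n => M.pos (B n) := by
    rw [← limitRun_comp_strictMono hB.pos_prefix ht]
    exact congrArg limitRun (funext fun n => (h.pos (hr n)).symm)
  obtain ⟨hW, hF⟩ := hA B' hB'
  rw [hrun] at hW hF
  refine ⟨hW, hF.imp_left fun hF n => ?_⟩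
  obtain ⟨m, hm, hg⟩ := hF n
  obtain ⟨C, hC, hgC, -⟩ := h.step (hr m)
  obtain ⟨k, hk, rfl⟩ := hB.exists_of_reaches hC
  exact ⟨k, (hm.trans ht.le_apply).trans hk, hgC hg⟩

end Agent

/-- An easy-play machine as an agent. -/
def EPM.toAgent (M : EPM) : Agent where
  Cfg := M.Cfg
  init := M.init
  pos := EPM.Cfg.pos
  grants C := C.instr.2 = .grant
  next := EPM.Cfg.next
  next_of_not_grants {C} h e := by
    unfold EPM.Cfg.next
    rcases hC : C.instr with ⟨q, _ | _ | _ | _ | _⟩ <;> simp_all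
  pos_prefix_next C e := by
    unfold EPM.Cfg.next
    rcases C.instr with ⟨q, _ | _ | _ | _ | _⟩ <;> simp

end

/-! ### Stack programs -/

section

open Turing

theorem EPM.leading_eq_of_getI {M : EPM} {l : List M.Work} {β : Move}
    (h : ∀ i, M.key (l.getI i) = β[i]?) : M.leading l = β := by
  induction l generalizing β with
  | nil =>
    have := h 0
    rw [List.getI_nil, M.key_blank] at this
    rw [EPM.leading, eq_comm, ← List.length_eq_zero_iff]
    simpa using this.symm
  | cons a l ih =>
    have h0 : M.key a = β[0]? := h 0
    cases β with
    | nil => simp [EPM.leading, show M.key a = none from h0]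
    | cons c β =>
      simpa [EPM.leading, show M.key a = some c from h0] using ih fun i => h (i + 1)

theorem EPM.spelledMove_mk' {M : EPM} {R L : ListBlank M.Work} {β : Move}
    (h : ∀ i, M.key (L.nth i) = β[i]?) : M.spelledMove (Tape.mk' R L) = β := by
  rw [EPM.spelledMove, Tape.mk'_right₀]
  induction L using ListBlank.induction_on with
  | _ l => exact EPM.leading_eq_of_getI h

/-- An instruction of a one-tape Turing machine as an instruction of an easy-play machine. -/
def Instr.ofStmt {W : Type} : TM0.Stmt W → Instr W
  | .move d => .moveWork d
  | .write a => .write a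

theorem EPM.Cfg.next_of_tm0_step {M : EPM} {Λ : Type*} [Inhabited Λ] {N : TM0.Machine M.Work Λ}
    {C : M.Cfg} {q q' : Λ} {T : Tape M.Work} {r : M.State}
    (h : (⟨q', T⟩ : TM0.Cfg _ _) ∈ TM0.step N ⟨q, C.work⟩)
    (hC : ∀ s, N q C.work.head = some (q', s) → C.instr = (r, .ofStmt s)) :
    C.instr.2 ≠ .grant ∧ ⟨r, T, C.pos, C.runHead⟩ = C.next none := by
  obtain ⟨⟨_, s⟩, hs, hT⟩ := Option.map_eq_some_iff.1 h
  cases hT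
  cases s <;> simp [hC _ hs, EPM.Cfg.next, Instr.ofStmt]

theorem EPM.Cfg.next_of_write_head {M : EPM} {C : M.Cfg} {q : M.State}
    (h : C.instr = (q, .write C.work.head)) (e : Option Move) :
    C.next e = { C with state := q } := by
  simp [EPM.Cfg.next, h]

/-- What a program asks of the outside world: nothing, a step of the head of the run tape to the
right, to make the move that is spelled in its buffer, or to grant permission. -/
inductive Request where
  | idle
  | advance
  | makeMove
  | grant

namespace Request

/-- The instruction by which a machine serves a request; `w` is the symbol scanned on the work
tape, which is left unchanged. -/
def instr {W : Type} (w : W) : Request → Instr W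
  | idle => .write w
  | advance => .moveRun .right
  | makeMove => .makeMove
  | grant => .grant

/-- What is appended to the position when a request is served: `β` is the move in the buffer, and
`e` the reply of the environment to a permission. -/
def moves (β : Move) (e : Option Move) : Request → Position
  | makeMove => [(.top, β)]
  | grant => e.toList.map (.bot, ·)
  | _ => []

/-- The displacement of the head of the run tape when a request is served. -/
def shift : Request → ℕ
  | advance => 1
  | _ => 0

end Request

/-- A multi-stack program that interacts with the world. The label `entry r` at which a round of
its computation starts depends on the symbol `r` scanned on the run tape, and the round ends when
the program halts, with the request determined by its internal variable. The stack `buffer`,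
read from the bottom up, spells a move. -/
structure StackProgram where
  K : Type
  Γ : K → Type
  Λ : Type
  σ : Type
  [decK : DecidableEq K]
  [finK : Finite K]
  [finΓ : ∀ k, Finite (Γ k)]
  [inhΛ : Inhabited Λ]
  [inhσ : Inhabited σ]
  [finσ : Fintype σ]
  code : Λ → TM2.Stmt Γ Λ σ
  labels : Finset Λ
  supports : TM2.Supports code labels
  entry : Option RunSym → Λ
  entry_mem : ∀ r, entry r ∈ labels
  request : σ → Request
  buffer : K
  key : Γ buffer → Key

namespace StackProgram

attribute [instance] decK finK finΓ inhΛ inhσ finσ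

variable (P : StackProgram)

/-- Mathlib's translation of a multi-stack program into a one-tape program. -/
abbrev tapeCode : TM2to1.Λ' P.K P.Γ P.Λ P.σ →
    TM1.Stmt (TM2to1.Γ' P.K P.Γ) (TM2to1.Λ' P.K P.Γ P.Λ P.σ) P.σ :=
  TM2to1.tr P.code

/-- The states, finite in number, of the Turing machine into which the program is translated. -/
abbrev tapeStates : Finset (TM1to0.Λ' P.tapeCode) :=
  TM1to0.trStmts P.tapeCode (TM2to1.trSupp P.code P.labels)

theorem tapeStates_supports : TM0.Supports (TM1to0.tr P.tapeCode) P.tapeStates :=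
  TM1to0.tr_supports _ (TM2to1.tr_supports _ P.supports)

theorem entry_mem_tapeStates (r : Option RunSym) (v : P.σ) :
    (some (P.tapeCode (.normal (P.entry r))), v) ∈ P.tapeStates := by
  classical
  refine Finset.mem_product.2 ⟨Finset.some_mem_insertNone.2 ?_, Finset.mem_univ _⟩
  exact Finset.mem_biUnion.2 ⟨_, Finset.mem_biUnion.2 ⟨_, P.entry_mem r,
    Finset.mem_insert_self _ _⟩, TM1.stmts₁_self⟩

/-- The states of the easy-play machine that runs a program: the initial state, in which the
bottom of the stacks is marked, the states in which the run tape is read, and the states of the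
translated program. -/
abbrev State : Type := Option (P.σ ⊕ {q // q ∈ P.tapeStates})

/-- The transitions of the easy-play machine that runs a program. A halted program has its request
served, and starts the next round once the scanned symbol of the run tape has been read. -/
def trans : P.State → TM2to1.Γ' P.K P.Γ → Option RunSym →
    P.State × Instr (TM2to1.Γ' P.K P.Γ)
  | none, _, _ => (some (.inl default), .write (true, fun _ => none))
  | some (.inl v), w, r => (some (.inr ⟨_, P.entry_mem_tapeStates r v⟩), .write w)
  | some (.inr ⟨(none, v), _⟩), w, _ => (some (.inl v), (P.request v).instr w)
  | some (.inr ⟨(some s, v), h⟩), w, _ =>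
    (some (.inr ⟨(TM1to0.trAux P.tapeCode w s v).1, P.tapeStates_supports.2 rfl h⟩),
      .ofStmt (TM1to0.trAux P.tapeCode w s v).2)

/-- The easy-play machine that runs a program. A symbol of its work tape has a track for each stack,
and the track of the buffer spells the moves. -/
def toEPM : EPM where
  State := P.State
  Work := TM2to1.Γ' P.K P.Γ
  finWork := inferInstanceAs (Finite (Bool × ∀ k, Option (P.Γ k)))
  key w := (w.2 P.buffer).map P.key
  key_blank := rfl
  start := none
  trans := P.trans

variable {P}

/-- The machine is in the state `q`, its work tape holds the stacks `S` with the head at their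
bottom, and its run tape spells `Φ` with the head at `h`. -/
structure Shows (C : P.toEPM.Cfg) (q : P.State) (S : ∀ k, List (P.Γ k)) (Φ : Position) (h : ℤ) :
    Prop where
  state : C.state = q
  pos : C.pos = Φ
  runHead : C.runHead = h
  work : ∃ L : ListBlank (∀ k, Option (P.Γ k)),
    (∀ k, L.map (proj k) = ListBlank.mk ((S k).map some).reverse) ∧
      C.work = Tape.mk' ∅ (TM2to1.addBottom L)

theorem reaches_of_tm0_reaches {q q' : TM1to0.Λ' P.tapeCode} {T T' : Tape (TM2to1.Γ' P.K P.Γ)}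
    (h : StateTransition.Reaches (TM0.step (TM1to0.tr P.tapeCode)) ⟨q, T⟩ ⟨q', T'⟩)
    (hq : q ∈ P.tapeStates) (Φ : Position) (i : ℤ) :
    ∃ hq' : q' ∈ P.tapeStates, P.toEPM.toAgent.Reaches ⟨some (.inr ⟨q, hq⟩), T, Φ, i⟩
      ⟨some (.inr ⟨q', hq'⟩), T', Φ, i⟩ := by
  generalize hc : (⟨q', T'⟩ : TM0.Cfg _ _) = c at h
  induction h generalizing q' T' with
  | refl => cases hc; exact ⟨hq, .refl⟩
  | @tail b _ _ h ih =>
    obtain ⟨q₁, T₁⟩ := b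
    obtain ⟨hq₁, hr⟩ := ih rfl
    subst hc
    obtain ⟨⟨_, a⟩, ha, hT⟩ := Option.map_eq_some_iff.1 h
    cases hT
    refine ⟨P.tapeStates_supports.2 ha hq₁,
      hr.tail (EPM.Cfg.next_of_tm0_step (M := P.toEPM) h fun b hb => ?_)⟩
    obtain ⟨_ | s, v⟩ := q₁
    · cases hb
    · obtain rfl : _ = q' := congrArg Prod.fst (Option.some.inj hb)
      obtain rfl : _ = b := congrArg Prod.snd (Option.some.inj hb)
      rfl

theorem shows_init : ∃ C, P.toEPM.toAgent.Reaches P.toEPM.init C ∧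
    Shows C (some (.inl default)) (fun _ => []) [] 0 := by
  refine ⟨_, .single ⟨nofun, rfl⟩, rfl, rfl, rfl,
    default, fun _ => rfl, rfl⟩

theorem Shows.round {C : P.toEPM.Cfg} {v v' : P.σ} {S S' : ∀ k, List (P.Γ k)} {Φ : Position}
    {i : ℤ} (hC : Shows C (some (.inl v)) S Φ i)
    (hr : StateTransition.Reaches (TM2.step P.code) ⟨some (P.entry C.scanned), v, S⟩
      ⟨none, v', S'⟩) :
    ∃ C' q, P.toEPM.toAgent.Reaches C C' ∧ q.1 = (none, v') ∧ Shows C' (some (.inr q)) S' Φ i := by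
  obtain ⟨q, T, Φ, i⟩ := C
  obtain ⟨rfl, rfl, rfl, L, hL, rfl⟩ := hC
  obtain ⟨c₁, ⟨L', hL'⟩, hr₁⟩ :=
    StateTransition.tr_reaches (TM2to1.tr_respects P.code) ⟨L, hL⟩ hr
  obtain ⟨_, rfl, hr₂⟩ := StateTransition.tr_reaches (TM1to0.tr_respects P.tapeCode) rfl hr₁
  obtain ⟨hq, hr₃⟩ := reaches_of_tm0_reaches hr₂ (P.entry_mem_tapeStates _ v) Φ i
  refine ⟨_, _, .head ⟨?_, ?_⟩ hr₃, rfl, rfl, rfl, rfl, L', hL', rfl⟩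
  · nofun
  · exact (EPM.Cfg.next_of_write_head (M := P.toEPM)
      (C := ⟨some (.inl v), Tape.mk' ∅ (TM2to1.addBottom L), Φ, i⟩) rfl none).symm

theorem Shows.instr {C : P.toEPM.Cfg} {q} {v : P.σ} {S : ∀ k, List (P.Γ k)} {Φ : Position}
    {i : ℤ} (hC : Shows C (some (.inr q)) S Φ i) (hq : q.1 = (none, v)) :
    C.instr = (some (.inl v), (P.request v).instr C.work.head) := by
  obtain ⟨⟨_, _⟩, _⟩ := q
  cases hq
  rw [EPM.Cfg.instr, hC.state]
  rfl

theorem Shows.spelledMove {C : P.toEPM.Cfg} {q} {S : ∀ k, List (P.Γ k)} {Φ : Position} {i : ℤ}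
    (hC : Shows C q S Φ i) : P.toEPM.spelledMove C.work = (S P.buffer).reverse.map P.key := by
  obtain ⟨L, hL, hT⟩ := hC.work
  rw [hT]
  refine EPM.spelledMove_mk' fun n => ?_
  change ((((TM2to1.addBottom L).nth n).2 P.buffer).map P.key) = _
  rw [TM2to1.addBottom_nth_snd, TM2to1.stk_nth_val _ (hL _), List.getElem?_map]

theorem Shows.serve {C : P.toEPM.Cfg} {q} {v : P.σ} {S : ∀ k, List (P.Γ k)} {Φ : Position}
    {i : ℤ} (hC : Shows C (some (.inr q)) S Φ i) (hq : q.1 = (none, v)) (e : Option Move) :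
    Shows (C.next e) (some (.inl v)) S
      (Φ ++ (P.request v).moves ((S P.buffer).reverse.map P.key) e)
      (i + (P.request v).shift) := by
  have hm := hC.spelledMove
  have hi := hC.instr hq
  obtain ⟨hs, rfl, rfl, L, hL, hT⟩ := hC
  cases hv : P.request v with
  | idle =>
    rw [hv] at hi
    rw [EPM.Cfg.next_of_write_head hi]
    exact ⟨rfl, by simp [Request.moves], by simp [Request.shift], L, hL, hT⟩
  | _ =>
    simp only [EPM.Cfg.next, hi, hv, hm, Request.instr]
    exact ⟨rfl, by simp [Request.moves], by simp [Request.shift, EPM.shift], L, hL, hT⟩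

end StackProgram

end

/-! ### Programs with a computable response -/

section

open Turing Turing.PartrecToTM2 Turing.ToPartrec Encodable
open scoped Computability

theorem exists_code_encode {α β γ : Type*} [Primcodable α] [Primcodable β] [Primcodable γ]
    {g : α → β → γ} (hg : Computable₂ g) :
    ∃ c : Code, ∀ a b, c.eval [encode a, encode b] = pure [encode (g a b)] := by
  let f : ℕ → ℕ → ℕ := fun m n =>
    ((decode (α := α) m).bind fun a => (decode (α := β) n).map fun b => encode (g a b)).getD 0
  have hf : Computable₂ f := by
    refine (Computable.option_bind (Computable.decode.comp .fst) ?_).option_getD (.const 0)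
    exact Computable.option_map (Computable.decode.comp (Computable.snd.comp .fst))
      (Computable.encode.comp (hg.comp (Computable.snd.comp .fst) .snd)).to₂
  obtain ⟨c, hc⟩ := Code.exists_code (Nat.Partrec'.part_iff₂.2 hf.partrec₂)
  exact ⟨c, fun a b => by
    simpa [f, List.Vector.head, List.Vector.tail] using hc ⟨[encode a, encode b], rfl⟩⟩

theorem trNat_two_pow (i : ℕ) : trNat (2 ^ i) = List.replicate i Γ'.bit0 ++ [Γ'.bit1] := by
  obtain ⟨p, hp, h⟩ : ∃ p : PosNum, ((2 ^ i : ℕ) : Num) = .pos p ∧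
      trPosNum p = List.replicate i Γ'.bit0 ++ [Γ'.bit1] := by
    induction i with
    | zero => exact ⟨1, rfl, rfl⟩
    | succ i ih =>
      obtain ⟨p, hp, h⟩ := ih
      refine ⟨p.bit0, ?_, by rw [trPosNum, h]; rfl⟩
      rw [pow_succ, mul_two, Nat.cast_add, hp, Num.bit0_of_bit0, Num.bit0]
  rw [trNat, hp, trNum, h]

/-- The primitive recursive encoding of a finite type by its enumeration. -/
abbrev primcodableOfFintype (α : Type*) [Fintype α] : Primcodable α :=
  .ofEquiv _ (Fintype.equivFin α)

/-- What a controller can do in a step: push or pop a keyboard symbol on the buffer that holds the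
next move, make this move, move the head of the run tape to the right, or grant permission. -/
inductive Action where
  | push (c : Key)
  | pop
  | emit
  | right
  | grant
  deriving DecidableEq, Fintype

instance : Primcodable Action := primcodableOfFintype _
instance : Primcodable Key := primcodableOfFintype _
instance : Primcodable RunSym := primcodableOfFintype _

namespace Action

/-- The effect of an action on the buffer, a stack. -/
def onBuffer : Action → Move → Move
  | push c, b => c :: b
  | pop, b => b.tail
  | _, b => b

/-- The request by which an action is passed on to the outside world. -/
def request : Action → Request
  | push _ | pop => .idle
  | emit => .makeMove
  | right => .advance
  | grant => .grant

end Action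

/-- A device with a memory in `D` that reads the run tape from left to right: depending on the
scanned symbol and the memory, it performs an action and changes the memory. -/
structure Controller (D : Type) where
  start : D
  step : Option RunSym → D → Action × D

namespace Controller

variable {D : Type}

/-- A configuration of a controller. The buffer, a stack, spells a move from the bottom up. -/
structure Cfg (D : Type) where
  mem : D
  buffer : Move
  pos : Position
  head : ℕ

/-- The symbol of the run tape that is scanned by the head. -/
def Cfg.scanned (C : Cfg D) : Option RunSym := (spell C.pos)[C.head]?

/-- The effect of an action, where `e` is the reply of the environment to a permission and `d` the
new memory. -/
def Cfg.perform (C : Cfg D) (e : Option Move) (x : Action × D) : Cfg D where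
  mem := x.2
  buffer := x.1.onBuffer C.buffer
  pos := C.pos ++ x.1.request.moves (x.1.onBuffer C.buffer).reverse e
  head := C.head + x.1.request.shift

namespace Cfg

variable (C : Cfg D) (e : Option Move) (d : D)

theorem perform_push (c : Key) :
    C.perform e (.push c, d) = ⟨d, c :: C.buffer, C.pos, C.head⟩ :=
  congrArg (mk d _ · _) (List.append_nil _)

theorem perform_pop : C.perform e (.pop, d) = ⟨d, C.buffer.tail, C.pos, C.head⟩ :=
  congrArg (mk d _ · _) (List.append_nil _)

theorem perform_emit :
    C.perform e (.emit, d) = ⟨d, C.buffer, C.pos ++ [(.top, C.buffer.reverse)], C.head⟩ :=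
  rfl

theorem perform_right : C.perform e (.right, d) = ⟨d, C.buffer, C.pos, C.head + 1⟩ :=
  congrArg (mk d _ · _) (List.append_nil _)

theorem perform_grant :
    C.perform e (.grant, d) = ⟨d, C.buffer, C.pos ++ e.toList.map (.bot, ·), C.head⟩ :=
  rfl

end Cfg

/-- A controller as an agent. -/
def toAgent (P : Controller D) : Agent where
  Cfg := Cfg D
  init := ⟨P.start, [], [], 0⟩
  pos := Cfg.pos
  grants C := (P.step C.scanned C.mem).1 = .grant
  next C e := C.perform e (P.step C.scanned C.mem)
  next_of_not_grants {C} h e := by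
    rcases hx : P.step C.scanned C.mem with ⟨_ | _ | _ | _ | _, d⟩ <;> simp_all <;> rfl
  pos_prefix_next _ _ := List.prefix_append _ _

/-- The labels of the stack program of a controller: `enter r` puts the scanned symbol `r` into the
input, `sim q` belongs to the program that computes the step function of the controller, and
`dispatch` performs the action that was computed. -/
inductive Label where
  | enter (r : Option RunSym)
  | sim (q : Λ')
  | dispatch

instance : Inhabited Label := ⟨.dispatch⟩

/-- The symbols of the stacks of a controller: the buffer and the stacks of the program that
computes its step function. -/
abbrev Symbol : Option K' → Type
  | none => Key
  | some _ => Γ'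

/-- A statement of the stack program of a controller. -/
abbrev Stmt := TM2.Stmt Symbol Label (Option Γ')

/-- The contents of all stacks, given the buffer and the stacks of the computing program. -/
def withBuffer (b : Move) (S : K' → List Γ') : ∀ k, List (Symbol k)
  | none => b
  | some k => S k

/-- The encoding of a request in the internal variable. -/
def varOfRequest : Request → Option Γ'
  | .idle => none
  | .advance => some .bit0
  | .makeMove => some .bit1
  | .grant => some .cons

/-- The request encoded by the internal variable. -/
def requestOfVar : Option Γ' → Request
  | some .bit0 => .advance
  | some .bit1 => .makeMove
  | some .cons => .grant
  | _ => .idle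

theorem requestOfVar_varOfRequest (r : Request) : requestOfVar (varOfRequest r) = r := by
  cases r <;> rfl

/-- Halts after performing an action on the buffer, with the request in the internal variable. -/
def actionStmt (a : Action) : Stmt :=
  let finish : Stmt := .load (fun _ => varOfRequest a.request) .halt
  match a with
  | .push c => .push none (fun _ => c) finish
  | .pop => .pop none (fun v _ => v) finish
  | _ => finish

/-- Performs the `i`-th action of a list if the number on the main stack is `2 ^ i`. -/
def dispatchStmt : List Action → Stmt
  | [] => .halt
  | a :: l => .pop (some .main) (fun _ s => s) <|
      .branch (fun s => s = some Γ'.bit0) (dispatchStmt l) <|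
        .pop (some .main) (fun v _ => v) (actionStmt a)

/-- Pushes a word on the main stack and continues with `q`. -/
def pushStmt (q : Stmt) : List Γ' → Stmt
  | [] => q
  | s :: l => pushStmt (.push (some .main) (fun _ => s) q) l

/-- A statement of the computing program, which is followed by `dispatch`. -/
def simStmt : TM2.Stmt (fun _ : K' => Γ') Λ' (Option Γ') → Stmt
  | .push k f q => .push (some k) f (simStmt q)
  | .peek k f q => .peek (some k) f (simStmt q)
  | .pop k f q => .pop (some k) f (simStmt q)
  | .load f q => .load f (simStmt q)
  | .branch f q₁ q₂ => .branch f (simStmt q₁) (simStmt q₂)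
  | .goto l => .goto fun v => .sim (l v)
  | .halt => .goto fun _ => .dispatch

theorem update_withBuffer (b : Move) (S : K' → List Γ') (k : K') (l : List Γ') :
    Function.update (withBuffer b S) (some k) l = withBuffer b (Function.update S k l) := by
  funext i
  rcases i with _ | i
  · rfl
  · rcases eq_or_ne i k with rfl | h <;> simp [withBuffer, *]

theorem update_withBuffer_none (b b' : Move) (S : K' → List Γ') :
    Function.update (withBuffer b S) none b' = withBuffer b' S := by
  funext i
  cases i <;> simp [withBuffer]

theorem stepAux_simStmt (b : Move) (q v) (S : K' → List Γ') :
    TM2.stepAux (simStmt q) v (withBuffer b S) =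
      let c := TM2.stepAux q v S
      ⟨some (c.l.elim .dispatch .sim), c.var, withBuffer b c.stk⟩ := by
  induction q generalizing v S with
  | branch f q₁ q₂ ih₁ ih₂ => cases h : f v <;> simp [simStmt, h, ih₁, ih₂]
  | goto | halt => rfl
  | load _ _ ih => exact ih _ _
  | push k f q ih | pop k f q ih =>
    rw [simStmt, TM2.stepAux, update_withBuffer, ih]
    rfl
  | peek _ _ _ ih => exact ih _ _

theorem stepAux_actionStmt (a : Action) (b : Move) (v) (S : K' → List Γ') :
    TM2.stepAux (actionStmt a) v (withBuffer b S) =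
      ⟨none, varOfRequest a.request, withBuffer (a.onBuffer b) S⟩ := by
  cases a <;>
    simp [actionStmt, Action.request, Action.onBuffer, update_withBuffer_none] <;> rfl

theorem stepAux_dispatchStmt {l : List Action} {a : Action} (ha : a ∈ l) (b : Move) (v)
    (T : List Γ') :
    TM2.stepAux (dispatchStmt l) v
      (withBuffer b (K'.elim (trNat (2 ^ l.idxOf a) ++ Γ'.cons :: T) [] [] [])) =
      ⟨none, varOfRequest a.request, withBuffer (a.onBuffer b) (K'.elim T [] [] [])⟩ := by
  induction l generalizing v with
  | nil => simp at ha
  | cons a' l ih =>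
    rw [trNat_two_pow] at ih ⊢
    rw [dispatchStmt, TM2.stepAux, update_withBuffer, K'.elim_update_main]
    by_cases h : a' = a
    · subst h
      simp [withBuffer, update_withBuffer, stepAux_actionStmt]
    · simpa [withBuffer, h, List.idxOf_cons_ne, List.replicate_succ] using
        ih ((List.mem_cons.1 ha).resolve_left (Ne.symm h)) _

theorem stepAux_pushStmt (l : List Γ') (q : Stmt) (b : Move) (v) (T : List Γ') :
    TM2.stepAux (pushStmt q l) v (withBuffer b (K'.elim T [] [] [])) =
      TM2.stepAux q v (withBuffer b (K'.elim (l ++ T) [] [] [])) := by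
  induction l generalizing q with
  | nil => rfl
  | cons s l ih =>
    rw [pushStmt, ih, TM2.stepAux, update_withBuffer, K'.elim_update_main]
    rfl

/-- The statements of a stack program that runs `c` on the scanned symbol and the memory, and then
performs the action that was computed. -/
def code (c : Code) : Label → Stmt
  | .enter r => .load (fun _ => none) <|
      pushStmt (.goto fun _ => .sim (trNormal c .halt)) (trList [encode r])
  | .sim q => simStmt (tr q)
  | .dispatch => dispatchStmt Finset.univ.toList

open scoped Classical in
/-- The labels that are reachable when `c` is run. -/
def labels (c : Code) : Finset Label :=
  Finset.univ.image .enter ∪ (codeSupp c .halt).image .sim ∪ {.dispatch}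

theorem supportsStmt_simStmt {c : Code} {q} (hq : TM2.SupportsStmt (codeSupp c .halt) q) :
    TM2.SupportsStmt (labels c) (simStmt q) := by
  induction q with
  | branch f q₁ q₂ ih₁ ih₂ => exact ⟨ih₁ hq.1, ih₂ hq.2⟩
  | goto l => exact fun v => by simpa [labels] using hq v
  | halt => exact fun _ => by simp [labels]
  | load f q ih | push k f q ih | pop k f q ih | peek k f q ih => exact ih hq

theorem supportsStmt_dispatchStmt (S : Finset Label) (l : List Action) :
    TM2.SupportsStmt S (dispatchStmt l) := by
  induction l with
  | nil => trivial
  | cons a l ih => exact ⟨ih, by cases a <;> trivial⟩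

theorem supportsStmt_pushStmt {S : Finset Label} {q : Stmt} (hq : TM2.SupportsStmt S q)
    (l : List Γ') : TM2.SupportsStmt S (pushStmt q l) := by
  induction l generalizing q with
  | nil => exact hq
  | cons _ _ ih => exact ih hq

theorem supports_code (c : Code) : TM2.Supports (code c) (labels c) := by
  refine ⟨by simp [labels, default], fun q hq => ?_⟩
  cases q with
  | enter r =>
    refine supportsStmt_pushStmt (fun _ => ?_) _
    simpa [labels] using (tr_supports c .halt).1
  | sim q => exact supportsStmt_simStmt ((tr_supports c .halt).2 q (by simpa [labels] using hq))
  | dispatch => exact supportsStmt_dispatchStmt _ _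

instance : Finite K' := .of_surjective
  (fun | 0 => .main | 1 => .rev | 2 => .aux | 3 => .stack : Fin 4 → K')
  fun k => by cases k <;> decide

instance (k : Option K') : Finite (Symbol k) := by
  cases k <;> infer_instance

/-- The stack program that runs `c` in each round. -/
def program (c : Code) : StackProgram where
  K := Option K'
  Γ := Symbol
  Λ := Label
  σ := Option Γ'
  code := code c
  labels := labels c
  supports := supports_code c
  entry := .enter
  entry_mem := by simp [labels]
  request := requestOfVar
  buffer := none
  key := id

theorem reaches_sim (c : Code) {q : Λ'} {v} {S S' : K' → List Γ'} {v'}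
    (h : StateTransition.Reaches (TM2.step tr) ⟨some q, v, S⟩ ⟨none, v', S'⟩) (b : Move) :
    StateTransition.Reaches (TM2.step (code c)) ⟨some (.sim q), v, withBuffer b S⟩
      ⟨some .dispatch, v', withBuffer b S'⟩ := by
  refine h.lift (fun a : TM2.Cfg _ Λ' _ =>
    (⟨some (a.l.elim .dispatch .sim), a.var, withBuffer b a.stk⟩ : TM2.Cfg Symbol Label _)) ?_
  intro a₁ a₂ h
  obtain ⟨_ | q, v, S⟩ := a₁
  · cases h
  · cases h
    exact congrArg some (stepAux_simStmt b (tr q) v S)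

theorem reaches_trNormal {c : Code} {l l' : List ℕ} (h : c.eval l = pure l') :
    StateTransition.Reaches (TM2.step tr) (init c l) (halt l') := by
  refine (StateTransition.mem_eval.1 ?_).1
  rw [tr_eval, h]
  exact ⟨trivial, rfl⟩

theorem reaches_program {c : Code} {r : Option RunSym} {l : List ℕ} {a : Action} {n : ℕ}
    (hc : c.eval (encode r :: l) = pure [2 ^ Finset.univ.toList.idxOf a, n]) (v) (b : Move) :
    StateTransition.Reaches (TM2.step (program c).code)
      ⟨some ((program c).entry r), v, withBuffer b (K'.elim (trList l) [] [] [])⟩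
      ⟨none, varOfRequest a.request,
        withBuffer (a.onBuffer b) (K'.elim (trList [n]) [] [] [])⟩ := by
  refine .head ?_ ((reaches_sim c (reaches_trNormal hc) b).tail ?_)
  · refine congrArg some ((stepAux_pushStmt _ _ b none _).trans ?_)
    simp [TM2.stepAux]
  · exact congrArg some (stepAux_dispatchStmt (Finset.mem_toList.2 (Finset.mem_univ a)) b none _)

theorem exists_code_step [Primcodable D] {P : Controller D} (hP : Computable₂ P.step) :
    ∃ c : Code, ∀ r (o : Option D) (l : List ℕ), l.headI = encode o →
      c.eval (encode r :: l) = pure [2 ^ Finset.univ.toList.idxOf (P.step r (o.getD P.start)).1,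
        encode (some (P.step r (o.getD P.start)).2)] := by
  have hs : Computable fun p : Option RunSym × Option D => P.step p.1 (p.2.getD P.start) :=
    hP.comp .fst (Computable.option_getD .snd (.const _))
  obtain ⟨c₁, h₁⟩ := exists_code_encode
    (g := fun r (o : Option D) => 2 ^ Finset.univ.toList.idxOf (P.step r (o.getD P.start)).1)
    ((Primrec.dom_finite fun a : Action => 2 ^ Finset.univ.toList.idxOf a).to_comp.comp
      (Computable.fst.comp hs)).to₂
  obtain ⟨c₂, h₂⟩ := exists_code_encode (g := fun r (o : Option D) =>
    some (P.step r (o.getD P.start)).2) (Computable.option_some.comp (Computable.snd.comp hs)).to₂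
  refine ⟨(Code.cons c₁ c₂).comp (Code.cons Code.head (Code.head.comp Code.tail)),
    fun r o l hl => ?_⟩
  have h : (Code.head.comp Code.tail).eval (encode r :: l) = pure [encode o] :=
    (Part.bind_some _ _).trans (by rw [List.tail, Code.head_eval, hl])
  simp [-encode_some, -Code.comp_eval, Code.comp_eval (Code.cons c₁ c₂), h, h₁, h₂]

theorem exists_simulates [Primcodable D] {P : Controller D} (hP : Computable₂ P.step) :
    ∃ (M : EPM) (Rep : _), M.toAgent.Simulates P.toAgent Rep := by
  obtain ⟨c, hc⟩ := exists_code_step hP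
  refine ⟨(program c).toEPM, fun C C' => ∃ v l, ∃ o : Option D, l.headI = encode o ∧
    o.getD P.start = C'.mem ∧ StackProgram.Shows C (some (.inl v))
      (withBuffer C'.buffer (K'.elim (trList l) [] [] [])) C'.pos C'.head, ?_, ?_, ?_⟩
  · obtain ⟨C, hr, hC⟩ := (program c).shows_init
    have h0 : (withBuffer [] (K'.elim (trList []) [] [] []) : ∀ k, List (Symbol k)) =
        fun _ => [] := by
      funext k
      rcases k with _ | _ | _ <;> rfl
    exact ⟨C, hr, default, [], none, rfl, rfl, h0 ▸ hC⟩
  · rintro C C' ⟨v, l, o, -, -, hC⟩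
    exact hC.pos
  · rintro C C' ⟨v, l, o, hl, ho, hC⟩
    have hs : C.scanned = C'.scanned := by
      simp [EPM.Cfg.scanned, Cfg.scanned, hC.pos, hC.runHead]
    obtain ⟨C₁, q, hr, hq, hC₁⟩ := hC.round (reaches_program (hc C.scanned o l hl) v C'.buffer)
    rw [ho, hs] at hq hC₁
    refine ⟨C₁, hr, fun hg => ?_, fun e => ⟨_, .refl,
      varOfRequest (P.step C'.scanned C'.mem).1.request,
      [encode (some (P.step C'.scanned C'.mem).2)], some _, rfl, rfl, ?_⟩⟩
    · change C₁.instr.2 = .grant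
      rw [hC₁.instr hq, show (P.step C'.scanned C'.mem).1 = .grant from hg]
      rfl
    · have hC₂ := hC₁.serve hq e
      rw [show (program c).request _ = _ from requestOfVar_varOfRequest _, ← Nat.cast_add] at hC₂
      have hb := List.map_id ((P.step C'.scanned C'.mem).1.onBuffer C'.buffer).reverse
      exact (congrArg (fun β =>
        StackProgram.Shows _ _ _ (C'.pos ++ Request.moves β e _) _) hb).mp hC₂

theorem exists_wins [Primcodable D] {P : Controller D} (hP : Computable₂ P.step) :
    ∃ M : EPM, ∀ A : Game, P.toAgent.Wins A → M.Wins A :=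
  let ⟨M, _, h⟩ := exists_simulates hP
  ⟨M, fun _ => h.wins⟩

end Controller

end

/-! ### Strategies -/

section

/-- A strategy with memory in `D` which waits for a move of the environment, and then updates the
memory and makes a list of moves. -/
structure Strategy (D : Type) where
  start : D
  respond : D → Move → D × List Move

namespace Strategy

variable {D : Type}

/-- A strategy as an agent, which grants permission at all times. -/
def toAgent (S : Strategy D) : Agent where
  Cfg := D × Position
  init := (S.start, [])
  pos := Prod.snd
  grants _ := True
  next
    | C, none => C
    | (d, Φ), some m =>
      ((S.respond d m).1, Φ ++ (.bot, m) :: (S.respond d m).2.map (Prod.mk .top))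
  next_of_not_grants h := absurd trivial h
  pos_prefix_next C e := by
    cases e
    · exact List.prefix_rfl
    · exact List.prefix_append _ _

/-- The actions by which a controller with an empty buffer makes the move `m`. -/
def write (m : Move) : List Action :=
  m.map .push ++ .emit :: m.map fun _ => .pop

/-- Reads a symbol of the run tape, where the state is the last move read so far if it is a move of
the environment. -/
def read : Option Move → RunSym → Option Move
  | _, .label .bot => some []
  | _, .label .top => none
  | i, .key c => i.map (· ++ [c])

/-- The controller that follows a strategy. It remembers the memory of the strategy, the part of a
move of the environment that it has read, and a queue of actions. -/
def controller (S : Strategy D) : Controller (D × Option Move × List Action) where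
  start := (S.start, none, [])
  step
    | _, (d, i, a :: q) => (a, d, i, q)
    | some s, (d, i, []) => (.right, d, read i s, [])
    | none, (d, none, []) => (.grant, d, none, [])
    -- Popping the empty buffer does nothing.
    | none, (d, some m, []) => (.pop, (S.respond d m).1, none, (S.respond d m).2.flatMap write)

variable {S : Strategy D} {d : D} {i : Option Move} {q : List Action} {Φ : Position} {h : ℕ}

theorem reaches_head {C C' : S.controller.toAgent.Cfg} {x : Action × D × Option Move × List Action}
    (hx : S.controller.step C.scanned C.mem = x) (ha : x.1 ≠ .grant)
    (h : S.controller.toAgent.Reaches (C.perform none x) C') : S.controller.toAgent.Reaches C C' :=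
  .head ⟨by rwa [← hx] at ha, hx ▸ rfl⟩ h

theorem reaches_push (m b : Move) :
    S.controller.toAgent.Reaches ⟨(d, i, m.map .push ++ q), b, Φ, h⟩
      ⟨(d, i, q), m.reverse ++ b, Φ, h⟩ := by
  induction m generalizing b with
  | nil => exact .refl
  | cons c m ih =>
    refine reaches_head (x := (.push c, d, i, m.map .push ++ q)) rfl (by simp) ?_
    simpa [Controller.Cfg.perform_push] using ih (c :: b)

theorem reaches_pop (b : Move) :
    S.controller.toAgent.Reaches ⟨(d, i, b.map (fun _ => .pop) ++ q), b, Φ, h⟩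
      ⟨(d, i, q), [], Φ, h⟩ := by
  induction b with
  | nil => exact .refl
  | cons c b ih =>
    refine reaches_head (x := (.pop, d, i, b.map (fun _ => .pop) ++ q)) rfl (by simp) ?_
    rwa [Controller.Cfg.perform_pop]

theorem reaches_write (m : Move) :
    S.controller.toAgent.Reaches ⟨(d, i, write m ++ q), [], Φ, h⟩
      ⟨(d, i, q), [], Φ ++ [(.top, m)], h⟩ := by
  rw [write, List.append_assoc]
  refine (reaches_push m []).trans
    (reaches_head (x := (.emit, d, i, m.map (fun _ => .pop) ++ q)) rfl (by simp) ?_)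
  simpa [Controller.Cfg.perform_emit] using
    reaches_pop (S := S) (d := d) (i := i) (q := q) (Φ := Φ ++ [(.top, m)]) (h := h) m.reverse

theorem reaches_flatMap_write (l : List Move) :
    S.controller.toAgent.Reaches ⟨(d, i, l.flatMap write), [], Φ, h⟩
      ⟨(d, i, []), [], Φ ++ l.map (Prod.mk .top), h⟩ := by
  induction l generalizing Φ with
  | nil => rw [List.map_nil, List.append_nil]; exact .refl
  | cons m l ih =>
    rw [List.map_cons, List.append_cons]
    exact (reaches_write m).trans ih

theorem reaches_read (s t : List RunSym) (hst : spell Φ = s ++ t) :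
    S.controller.toAgent.Reaches ⟨(d, i, []), [], Φ, s.length⟩
      ⟨(d, t.foldl read i, []), [], Φ, (spell Φ).length⟩ := by
  induction t generalizing s i with
  | nil => rw [hst, List.append_nil]; exact .refl
  | cons c t ih =>
    refine reaches_head (x := (.right, d, read i c, [])) ?_ (by simp) ?_
    · simp [Controller.Cfg.scanned, hst, controller]
    · simpa [Controller.Cfg.perform_right] using ih (s ++ [c]) (by simp [hst])

theorem foldl_read_spell_bot (m : Move) : (spell [(.bot, m)]).foldl read i = some m := by
  have h : ∀ l : Move, (m.map RunSym.key).foldl read (some l) = some (l ++ m) := by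
    induction m with
    | nil => simp
    | cons c m ih => simp [read, ih]
  simpa [spell, read] using h []

theorem foldl_read_spell_top (l : List Move) :
    (spell (l.map (Prod.mk .top))).foldl read none = none := by
  have h : ∀ m : Move, (m.map RunSym.key).foldl read none = none := fun m => by
    induction m with
    | nil => rfl
    | cons _ _ ih => exact ih
  induction l with
  | nil => rfl
  | cons m l ih => simpa [spell, read, h] using ih

theorem spell_append (Φ Ψ : Position) : spell (Φ ++ Ψ) = spell Φ ++ spell Ψ :=
  List.flatMap_append

theorem reaches_respond (m : Move) :
    S.controller.toAgent.Reaches ⟨(d, none, []), [], Φ ++ [(.bot, m)], (spell Φ).length⟩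
      ⟨((S.respond d m).1, none, []), [],
        Φ ++ (.bot, m) :: (S.respond d m).2.map (Prod.mk .top),
        (spell (Φ ++ (.bot, m) :: (S.respond d m).2.map (Prod.mk .top))).length⟩ := by
  have h₁ := reaches_read (S := S) (d := d) (i := none) _ _ (spell_append Φ [(.bot, m)])
  rw [foldl_read_spell_bot] at h₁
  have h₂ := reaches_flatMap_write (S := S) (d := (S.respond d m).1) (i := none)
    (Φ := Φ ++ [(.bot, m)]) (h := (spell (Φ ++ [(.bot, m)])).length) (S.respond d m).2
  have h₃ := reaches_read (S := S) (d := (S.respond d m).1) (i := none) _ _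
    (spell_append (Φ ++ [(.bot, m)]) ((S.respond d m).2.map (Prod.mk .top)))
  rw [foldl_read_spell_top] at h₃
  refine h₁.trans
    (reaches_head (x := (.pop, (S.respond d m).1, none, (S.respond d m).2.flatMap write)) ?_
      (by simp) ?_)
  · simp [Controller.Cfg.scanned, controller]
  · rw [Controller.Cfg.perform_pop]
    rw [List.append_cons Φ _ (List.map _ _)]
    exact h₂.trans h₃

theorem simulates_controller (S : Strategy D) :
    S.controller.toAgent.Simulates S.toAgent fun C C' =>
      C = ⟨(C'.1, none, []), [], C'.2, (spell C'.2).length⟩ where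
  init := ⟨_, .refl, rfl⟩
  pos h := h ▸ rfl
  step := by
    rintro _ ⟨d, Φ⟩ rfl
    have hs : S.controller.step (spell Φ)[(spell Φ).length]? (d, none, []) =
        (.grant, d, none, []) := by simp [controller]
    refine ⟨_, .refl, fun _ => congrArg Prod.fst hs, fun e => ⟨_, ?_, rfl⟩⟩
    change S.controller.toAgent.Reaches (Controller.Cfg.perform _ e (S.controller.step _ _)) _
    rw [Controller.Cfg.scanned, hs, Controller.Cfg.perform_grant]
    cases e with
    | none => rw [Option.toList_none, List.map_nil, List.append_nil]; exact .refl
    | some m => exact reaches_respond m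

theorem primrec_write : Primrec write :=
  Primrec.list_append.comp (.list_map .id ((Primrec.dom_finite Action.push).comp .snd).to₂)
    (Primrec.list_cons.comp (.const _) (.list_map .id (.const _)))

theorem primrec_read : Primrec₂ read := by
  let key? : RunSym → Option Key := fun | .key c => some c | _ => none
  have hk : Primrec key? := Primrec.dom_finite _
  have hl : Primrec (read none) := Primrec.dom_finite _
  refine Primrec.of_eq (Primrec.option_casesOn (hk.comp .snd) (hl.comp .snd)
    (Primrec.option_map (Primrec.fst.comp .fst) (Primrec.list_concat.comp .snd
      (Primrec.snd.comp .fst)).to₂).to₂) ?_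
  rintro ⟨i, (_ | _) | c⟩ <;> rfl

theorem computable_step [Primcodable D] (hS : Computable₂ S.respond) :
    Computable₂ S.controller.step := by
  let T := Option RunSym × D × Option Move × List Action
  have hd : Computable fun p : T => p.2.1 := .comp .fst .snd
  have hi : Computable fun p : T => p.2.2.1 := .comp .fst (.comp .snd .snd)
  have hq : Computable fun p : T => p.2.2.2 := .comp .snd (.comp .snd .snd)
  have hwait : Computable fun p : T =>
      ((.grant, p.2.1, none, []) : Action × D × Option Move × List Action) :=
    .pair (.const _) (.pair hd (.const _))
  have hrespond : Computable₂ fun (p : T) m => ((.pop, (S.respond p.2.1 m).1, none,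
      (S.respond p.2.1 m).2.flatMap write) : Action × D × Option Move × List Action) := by
    have hr := hS.comp (hd.comp .fst) (.snd (α := T) (β := Move))
    exact .pair (.const _) (.pair (.comp .fst hr) (.pair (.const _)
      ((Primrec.list_flatMap .id (primrec_write.comp .snd).to₂).to_comp.comp (.comp .snd hr))))
  have hread : Computable₂ fun (p : T) s =>
      ((.right, p.2.1, read p.2.2.1 s, []) : Action × D × Option Move × List Action) :=
    .pair (.const _) (.pair (hd.comp .fst) (.pair
      (primrec_read.to_comp.comp (hi.comp .fst) .snd) (.const _)))
  have hact : Computable₂ fun (p : T) (a : Action) => (a, p.2.1, p.2.2.1, p.2.2.2.tail) :=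
    .pair .snd (.pair (hd.comp .fst) (.pair (hi.comp .fst)
      (Primrec.list_tail.to_comp.comp (hq.comp .fst))))
  refine .of_eq (.option_casesOn (Primrec.list_head?.to_comp.comp hq)
    (.option_casesOn .fst (.option_casesOn hi hwait hrespond) hread) hact) ?_
  rintro ⟨_ | s, d, _ | m, _ | ⟨a, q⟩⟩ <;> rfl

theorem exists_wins [Primcodable D] (hS : Computable₂ S.respond) :
    ∃ M : EPM, ∀ A : Game, S.toAgent.Wins A → M.Wins A :=
  let ⟨M, h⟩ := Controller.exists_wins (computable_step hS)
  ⟨M, fun A hA => h A (S.simulates_controller.wins hA)⟩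

end Strategy

end

/-! ### Legal runs and winners of games -/

section

variable {A B C D : Game} {L : Set Run} {Φ : Position} {x : Bitstream}

theorem exists_illegalBy (hL : PrefixDetermined L) {Γ : Run} (h : Γ ∉ L) :
    ∃ p, IllegalBy L p Γ := by
  have hex : {Φ : Position | IsInitial Φ Γ ∧ (Φ : Run) ∉ L}.Nonempty := by
    by_contra! hc
    exact h ((hL Γ).2 fun Φ hΦ _ => by_contra fun hn => hc.le (show Φ ∈ _ from ⟨hΦ, hn⟩))
  obtain ⟨Φ, ⟨hΦ, hΦL⟩, hmin⟩ := (measure List.length).wf.has_min _ hex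
  rcases List.eq_nil_or_concat' Φ with rfl | ⟨Ψ, ⟨p, α⟩, rfl⟩
  · exact absurd hL.nil_mem hΦL
  · refine ⟨p, Ψ, α, hΦ, fun Θ hΘ => by_contra fun hn => ?_, hΦL⟩
    refine hmin Θ ⟨.trans (hΘ.trans (List.prefix_append _ _)) hΦ, hn⟩ ?_
    change Θ.length < (Ψ ++ [(p, α)]).length
    rw [List.length_append, List.length_singleton]
    exact Nat.lt_succ_of_le hΘ.length_le

theorem Game.ext_of_legal (h : A.Lr = B.Lr) (hW : ∀ Γ ∈ A.Lr, A.Wn Γ = B.Wn Γ) : A = B := by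
  refine Game.ext h (funext fun Γ => ?_)
  by_cases hΓ : Γ ∈ A.Lr
  · exact hW Γ hΓ
  · obtain ⟨p, hp⟩ := exists_illegalBy A.prefixDetermined hΓ
    rw [A.wn_of_illegalBy p Γ hp, B.wn_of_illegalBy p Γ (h ▸ hp)]

theorem Game.wn_ofLegal {hL : PrefixDetermined L} {W : Run → Prop} {Γ : Run} (h : Γ ∈ L) :
    (Game.ofLegal L hL W).Wn Γ = .top ↔ W Γ := by
  simp only [Game.ofLegal, if_pos h]
  split_ifs <;> simp_all

theorem Player.neg_eq_top {p : Player} : p.neg = .top ↔ p ≠ .top := by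
  cases p <;> simp [Player.neg]

theorem Player.eq_of_top_iff {p q : Player} (h : p = .top ↔ q = .top) : p = q := by
  cases p <;> cases q <;> simp_all

theorem Game.neg_neg (A : Game) : A.neg.neg = A := by
  refine Game.ext (Set.ext fun Γ => ?_) (funext fun Γ => ?_)
  · change Γ.neg.neg ∈ A.Lr ↔ _
    rw [Run.neg_neg]
  · change (A.Wn Γ.neg.neg).neg.neg = _
    rw [Run.neg_neg, Player.neg_neg]

theorem Game.neg_ofLegal {L' : Set Run} (hL : PrefixDetermined L) (hL' : PrefixDetermined L')
    {W W' : Run → Prop} (h : ∀ Γ, Γ ∈ L' ↔ Γ.neg ∈ L) (hW : ∀ Γ, W' Γ ↔ ¬ W Γ.neg) :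
    (Game.ofLegal L hL W).neg = Game.ofLegal L' hL' W' := by
  refine Game.ext_of_legal (Set.ext fun Γ => (h Γ).symm) fun Γ hΓ => ?_
  apply Player.eq_of_top_iff
  rw [Game.wn_ofLegal ((h Γ).2 hΓ), hW, ← Game.wn_ofLegal (hL := hL) (W := W) hΓ]
  exact Player.neg_eq_top

theorem limitRun_ext {P Q : ℕ → Position} (hP : ∀ m n, m ≤ n → P m <+: P n)
    (hQ : ∀ m n, m ≤ n → Q m <+: Q n) (h : ∀ n, ∃ m, P n <+: Q m) (h' : ∀ n, ∃ m, Q n <+: P m) :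
    limitRun P = limitRun Q := by
  refine Stream'.Seq.ext fun k => ?_
  by_cases hk : ∃ n, k < (P n).length
  · obtain ⟨n, hn⟩ := hk
    obtain ⟨m, hm⟩ := h n
    rw [limitRun_get? hP hn, limitRun_get? hQ (hn.trans_le hm.length_le),
      List.prefix_iff_getElem?.1 hm k hn, List.getElem?_eq_getElem hn]
  · simp only [not_exists, not_lt] at hk
    rw [limitRun_get?_none hk, limitRun_get?_none fun n =>
      let ⟨m, hm⟩ := h' n
      hm.length_le.trans (hk m)]

theorem limitRun_neg {P : ℕ → Position} (hP : ∀ m n, m ≤ n → P m <+: P n) :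
    (limitRun P).neg = limitRun fun n => Position.neg (P n) := by
  refine Stream'.Seq.ext fun k => ?_
  have hlen : ∀ n, (Position.neg (P n)).length = (P n).length := fun n => List.length_map _
  rw [Run.neg, Stream'.Seq.map_get?]
  by_cases hk : ∃ n, k < (P n).length
  · obtain ⟨n, hn⟩ := hk
    have hP' : ∀ m n, m ≤ n → Position.neg (P m) <+: Position.neg (P n) :=
      fun m n h => (hP m n h).map _
    rw [limitRun_get? hP hn, limitRun_get? hP' (hn.trans_eq (hlen n).symm), Position.neg,
      List.getElem?_map]
  · simp only [not_exists, not_lt] at hk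
    rw [limitRun_get?_none hk, limitRun_get?_none fun n => (hlen n).trans_le (hk n)]
    rfl

theorem filterMap_limitRun {P : ℕ → Position} (hP : ∀ m n, m ≤ n → P m <+: P n)
    (g : Labmove → Option Labmove) :
    Run.filterMap g (limitRun P) = limitRun fun n => (P n).filterMap g := by
  refine limitRun_ext (filterMap_take_mono g _) (fun m n h => (hP m n h).filterMap g)
    (fun n => ?_) fun n => ?_
  · obtain ⟨m, hm⟩ := prefix_of_isInitial_limitRun hP (isInitial_take (limitRun P) n)
    exact ⟨m, hm.filterMap g⟩
  · obtain ⟨m, hm⟩ := isInitial_limitRun hP n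
    exact ⟨m, by rw [hm]⟩

theorem limitRun_mem (hL : PrefixDetermined L) {P : ℕ → Position}
    (hP : ∀ m n, m ≤ n → P m <+: P n) (h : ∀ n, (P n : Run) ∈ L) : limitRun P ∈ L :=
  (hL _).2 fun _ hΦ _ =>
    let ⟨n, hn⟩ := prefix_of_isInitial_limitRun hP hΦ
    hL.of_prefix hn (h n)

theorem Run.take_neg (Γ : Run) (n : ℕ) : Γ.neg.take n = Position.neg (Γ.take n) := by
  apply List.ext_getElem?
  intro i
  rw [Stream'.Seq.getElem?_take, Position.neg, List.getElem?_map, Stream'.Seq.getElem?_take,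
    Run.neg, Stream'.Seq.map_get?]
  split_ifs <;> rfl

/-- The selection `g` of labmoves does not depend on labels, and preserves them. -/
def NegEquivariant (g : Labmove → Option Labmove) : Prop :=
  ∀ a, g (a.1.neg, a.2) = (g a).map fun b => (b.1.neg, b.2)

theorem NegEquivariant.filterMap_neg {g : Labmove → Option Labmove} (hg : NegEquivariant g)
    (Γ : Run) : Run.filterMap g Γ.neg = (Run.filterMap g Γ).neg := by
  have h (Φ : Position) : (Position.neg Φ).filterMap g = Position.neg (Φ.filterMap g) := by
    simp only [Position.neg, List.filterMap_map, List.map_filterMap]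
    exact congrArg (Φ.filterMap ·) (funext hg)
  unfold Run.filterMap
  rw [limitRun_neg (filterMap_take_mono g Γ)]
  simp only [Run.take_neg, h]

/-- Keeps the labmoves whose moves have the prefix `p`, and deletes that prefix. -/
def subMap (p : Move) (a : Labmove) : Option Labmove := (dropPre p a.2).map fun β => (a.1, β)

theorem negEquivariant_subMap (p : Move) : NegEquivariant (subMap p) := fun a => by
  simp [subMap, Function.comp_def]

theorem negEquivariant_threadMap (x : Bitstream) : NegEquivariant (threadMap x) := fun a => by
  unfold threadMap
  rcases parseAddr a.2 with _ | ⟨u, β⟩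
  · rfl
  · simp only
    split_ifs <;> rfl

theorem Run.sub_neg (p : Move) (Γ : Run) : Γ.neg.sub p = (Γ.sub p).neg :=
  (negEquivariant_subMap p).filterMap_neg Γ

theorem Run.thread_neg (x : Bitstream) (Γ : Run) : Γ.neg.thread x = (Γ.thread x).neg :=
  (negEquivariant_threadMap x).filterMap_neg Γ

theorem Run.forall_mem_neg (p : Move → Prop) (Γ : Run) :
    (∀ a ∈ Γ.neg, p a.2) ↔ ∀ a ∈ Γ, p a.2 := by
  simp only [Stream'.Seq.mem_iff_exists_get?, Run.neg, Stream'.Seq.map_get?]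
  constructor
  · rintro h a ⟨i, hi⟩
    exact h (a.1.neg, a.2) ⟨i, by rw [← hi]; rfl⟩
  · rintro h a ⟨i, hi⟩
    obtain ⟨b, hb, rfl⟩ := Option.map_eq_some_iff.1 hi.symm
    exact h b ⟨i, hb.symm⟩

theorem parLr_neg (A B : Game) (Γ : Run) :
    Γ ∈ parLr (fun i => if i then B.neg else A.neg) ↔
      Γ.neg ∈ parLr (fun i => if i then B else A) := by
  have h := Run.forall_mem_neg (fun m => ∃ i α, m = compPre i ++ α) Γ
  refine and_congr h.symm (forall_congr' fun i => ?_)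
  cases i <;> simp only [Run.sub_neg] <;> rfl

theorem branchLr_neg (A : Game) (Γ : Run) : Γ ∈ branchLr A.neg ↔ Γ.neg ∈ branchLr A := by
  have h := Run.forall_mem_neg (fun m => ∃ w α, m = addrMove w α) Γ
  refine and_congr h.symm (forall_congr' fun x => ?_)
  rw [Run.thread_neg]
  rfl

theorem Game.wn_neg_eq_top (A : Game) (Γ : Run) : A.neg.Wn Γ = .top ↔ A.Wn Γ.neg ≠ .top :=
  Player.neg_eq_top

theorem Game.and_neg (A B : Game) : (A.and B).neg = A.neg.or B.neg :=
  Game.neg_ofLegal _ _ (parLr_neg A B) fun Γ => by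
    rw [Run.sub_neg, Run.sub_neg, wn_neg_eq_top, wn_neg_eq_top, not_and_or]

theorem Game.or_neg (A B : Game) : (A.or B).neg = A.neg.and B.neg :=
  Game.neg_ofLegal _ _ (parLr_neg A B) fun Γ => by
    rw [Run.sub_neg, Run.sub_neg, wn_neg_eq_top, wn_neg_eq_top, not_or]

theorem Game.st_neg (A : Game) : A.st.neg = A.neg.cost :=
  Game.neg_ofLegal _ _ (branchLr_neg A) fun Γ => by
    simp only [Run.thread_neg, wn_neg_eq_top, not_forall]

theorem Game.cost_neg (A : Game) : A.cost.neg = A.neg.st :=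
  Game.neg_ofLegal _ _ (branchLr_neg A) fun Γ => by
    simp only [Run.thread_neg, wn_neg_eq_top, not_exists]

theorem Game.cstL_neg (A : Game) : A.cstL.neg = A.neg.ccostL :=
  Game.neg_ofLegal _ _ (branchLr_neg A) fun Γ => by
    simp only [Run.thread_neg, wn_neg_eq_top, not_forall, exists_prop]

theorem Game.ccostL_neg (A : Game) : A.ccostL.neg = A.neg.cstL :=
  Game.neg_ofLegal _ _ (branchLr_neg A) fun Γ => by
    simp only [Run.thread_neg, wn_neg_eq_top, not_exists, not_and]

theorem Formula.interp_neg {Atom : Type*} (I : Atom → Game) (F : Formula Atom) :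
    F.neg.interp I = (F.interp I).neg := by
  induction F with
  | atom P => rfl
  | natom P => exact (Game.neg_neg _).symm
  | and F G hF hG => simp only [Formula.neg, Formula.interp, hF, hG, Game.and_neg]
  | or F G hF hG => simp only [Formula.neg, Formula.interp, hF, hG, Game.or_neg]
  | st F hF => simp only [Formula.neg, Formula.interp, hF, Game.st_neg]
  | cost F hF => simp only [Formula.neg, Formula.interp, hF, Game.cost_neg]
  | cstT F hF => simp only [Formula.neg, Formula.interp, hF, Game.ccostT, Game.neg_neg]
  | ccostT F hF => simp only [Formula.neg, Formula.interp, hF, Game.ccostT, Game.neg_neg]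
  | cstL F hF => simp only [Formula.neg, Formula.interp, hF, Game.cstL_neg]
  | ccostL F hF => simp only [Formula.neg, Formula.interp, hF, Game.ccostL_neg]

theorem Formula.interp_imp {Atom : Type*} (I : Atom → Game) (F G : Formula Atom) :
    (F.imp G).interp I = (F.interp I).neg.or (G.interp I) := by
  rw [Formula.imp, Formula.interp, Formula.interp_neg]

end

/-! ### Imitation -/

section

theorem Strategy.wins_of_invariant {K : Type} {S : Strategy K} {A : Game}
    (Inv : K → Position → Prop) (Step : K → K → Prop) (refl : ∀ d, Step d d)
    (start : Inv S.start []) (legal : ∀ {d Φ}, Inv d Φ → (Φ : Run) ∈ A.Lr)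
    (step : ∀ {d Φ m}, Inv d Φ → ((Φ ++ [(.bot, m)] : Position) : Run) ∈ A.Lr →
      Inv (S.respond d m).1 (Φ ++ (.bot, m) :: (S.respond d m).2.map (Prod.mk .top)) ∧
        Step d (S.respond d m).1)
    (limit : ∀ (d : ℕ → K) (P : ℕ → Position), (∀ n, Inv (d n) (P n)) →
      (∀ n, Step (d n) (d (n + 1))) → (∀ m n, m ≤ n → P m <+: P n) →
        A.Wn (limitRun P) = .top) :
    S.toAgent.Wins A := by
  intro B hB
  have hP : ∀ m n, m ≤ n → (B m).2 <+: (B n).2 := hB.pos_prefix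
  refine ⟨?_, .inl fun n => ⟨n, le_rfl, trivial⟩⟩
  change A.Wn (limitRun fun n => (B n).2) = .top
  by_cases hill : IllegalBy A.Lr .bot (limitRun fun n => (B n).2)
  · exact A.wn_of_illegalBy _ _ hill
  have hnext {n} (h : Inv (B n).1 (B n).2) :
      Inv (B (n + 1)).1 (B (n + 1)).2 ∧ Step (B n).1 (B (n + 1)).1 := by
    obtain ⟨_ | m, he⟩ := hB.2 n
    · exact he ▸ ⟨h, refl _⟩
    · suffices hm : (((B n).2 ++ [(.bot, m)] : Position) : Run) ∈ A.Lr from he ▸ step h hm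
      by_contra hm
      refine hill ⟨_, m, .trans ?_ (isInitial_limitRun hP (n + 1)),
        fun Ψ hΨ => A.prefixDetermined.of_prefix hΨ (legal h), hm⟩
      exact he ▸ (List.prefix_append_right_inj _).2 ⟨_, rfl⟩
  have hInv (n) : Inv (B n).1 (B n).2 := by
    induction n with
    | zero => exact hB.1 ▸ start
    | succ n ih => exact (hnext ih).1
  exact limit (fun n => (B n).1) _ hInv (fun n => (hnext (hInv n)).2) hP

/-- The part of a position in the first (`false`) or the second (`true`) component of a disjunction
or a conjunction. -/
def component (i : Bool) (Φ : Position) : Position := Φ.filterMap (subMap (compPre i))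

/-- The part of a position of an implication in the antecedent, from the point of view of the
environment. -/
def antecedent (Φ : Position) : Position := Position.neg (component false Φ)

/-- The part of a position of an implication in the consequent. -/
def consequent (Φ : Position) : Position := component true Φ

/-- A move `μ` of the environment in the component `i`, answered by the moves `S` in the other
component. -/
def exchange (i : Bool) (μ : Move) (S : List Move) : Position :=
  (.bot, compPre i ++ μ) :: S.map fun m => (.top, compPre (!i) ++ m)

theorem component_append_exchange (i : Bool) (Φ : Position) (μ : Move) (S : List Move) :
    component i (Φ ++ exchange i μ S) = component i Φ ++ [(.bot, μ)] := by
  have hS : (S.map fun m => (Player.top, compPre (!i) ++ m)).filterMap (subMap (compPre i)) =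
      [] := by
    rw [List.filterMap_map, List.filterMap_eq_nil_iff]
    intro m _
    cases i <;> simp [subMap, dropPre, compPre]
  simp [component, exchange, hS, subMap, dropPre]

theorem component_not_append_exchange (i : Bool) (Φ : Position) (μ : Move) (S : List Move) :
    component (!i) (Φ ++ exchange i μ S) = component (!i) Φ ++ S.map (Prod.mk .top) := by
  have hμ : subMap (compPre !i) (.bot, compPre i ++ μ) = none := by
    cases i <;> simp [subMap, dropPre, compPre]
  rw [component, List.filterMap_append, exchange, List.filterMap_cons_none hμ]
  simp [component, List.filterMap_map, Function.comp_def, subMap, dropPre]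

variable {C D : Game} {Φ : Position} {μ : Move}

theorem mem_imp_Lr : (Φ : Run) ∈ (C.neg.or D).Lr ↔ (∀ a ∈ Φ, ∃ i μ, a.2 = compPre i ++ μ) ∧
    (antecedent Φ : Run) ∈ C.Lr ∧ (consequent Φ : Run) ∈ D.Lr := by
  change ((∀ a ∈ (Φ : Run), ∃ i μ, a.2 = compPre i ++ μ) ∧
    ∀ i, Run.filterMap (subMap (compPre i)) (Φ : Run) ∈ (if i then D else C.neg).Lr) ↔ _
  refine and_congr (by simp [Stream'.Seq.mem_iff_exists_get?, List.mem_iff_getElem?, eq_comm]) ?_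
  simp only [Run.filterMap_ofList, Bool.forall_bool, if_true, Bool.false_eq_true, if_false]
  refine and_congr ?_ Iff.rfl
  change Run.neg _ ∈ C.Lr ↔ _
  rw [Run.neg_ofList]
  rfl

theorem wn_imp_limitRun {P : ℕ → Position} (hP : ∀ m n, m ≤ n → P m <+: P n)
    (hleg : ∀ n, (P n : Run) ∈ (C.neg.or D).Lr)
    (h : C.Wn (limitRun fun n => antecedent (P n)) = .top →
      D.Wn (limitRun fun n => consequent (P n)) = .top) :
    (C.neg.or D).Wn (limitRun P) = .top := by
  refine (Game.wn_ofLegal (limitRun_mem (C.neg.or D).prefixDetermined hP hleg)).2 ?_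
  have hcons : (limitRun P).sub (compPre true) = limitRun fun n => consequent (P n) :=
    filterMap_limitRun hP _
  have hante : ((limitRun P).sub (compPre false)).neg = limitRun fun n => antecedent (P n) := by
    rw [Run.sub, filterMap_limitRun hP, limitRun_neg fun m n h => (hP m n h).filterMap _]
    rfl
  rw [Game.wn_neg_eq_top, hcons, hante]
  exact not_or_of_imp h

/-- A strategy for an implication which answers each move of the environment in one component by
moves in the other component. The first argument of `reply` tells whether the move of the
environment is in the consequent. -/
structure Imitation (K : Type) where
  start : K
  reply : Bool → K → Move → K × List Move

namespace Imitation

variable {K : Type} {S : Imitation K}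

/-- The strategy which reads off the component from the first key of a move. -/
def toStrategy (S : Imitation K) : Strategy K where
  start := S.start
  respond d m :=
    let i := decide (m.head? = some .two)
    ((S.reply i d (m.drop 2)).1, (S.reply i d (m.drop 2)).2.map (compPre (!i) ++ ·))

theorem append_respond (i : Bool) (d : K) (μ : Move) (Φ : Position) :
    Φ ++ (.bot, compPre i ++ μ) ::
        (S.toStrategy.respond d (compPre i ++ μ)).2.map (Prod.mk .top) =
      Φ ++ exchange i μ (S.reply i d μ).2 := by
  cases i <;> simp [toStrategy, exchange, compPre, Function.comp_def]

/-- The relation `Inv`, between the memory and the positions in the antecedent `C` and in the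
consequent `D`, is preserved by an imitation. -/
structure IsInvariant (S : Imitation K) (C D : Game) (Inv : K → Position → Position → Prop) :
    Prop where
  start : Inv S.start [] []
  legal_left {d T U} : Inv d T U → (T : Run) ∈ C.Lr
  legal_right {d T U} : Inv d T U → (U : Run) ∈ D.Lr
  left {d T U μ} : Inv d T U → ((T ++ [(.top, μ)] : Position) : Run) ∈ C.Lr →
    Inv (S.reply false d μ).1 (T ++ [(.top, μ)]) (U ++ (S.reply false d μ).2.map (Prod.mk .top))
  right {d T U μ} : Inv d T U → ((U ++ [(.bot, μ)] : Position) : Run) ∈ D.Lr →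
    Inv (S.reply true d μ).1 (T ++ (S.reply true d μ).2.map (Prod.mk .bot)) (U ++ [(.bot, μ)])

theorem IsInvariant.append_exchange {Inv : K → Position → Position → Prop}
    (h : S.IsInvariant C D Inv) {d : K} {i : Bool} (hΦ : Inv d (antecedent Φ) (consequent Φ))
    (hμ : ((Φ ++ [(.bot, compPre i ++ μ)] : Position) : Run) ∈ (C.neg.or D).Lr) :
    let Ψ := Φ ++ exchange i μ (S.reply i d μ).2
    Inv (S.reply i d μ).1 (antecedent Ψ) (consequent Ψ) := by
  obtain ⟨-, hT, hU⟩ := mem_imp_Lr.1 hμ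
  rw [show Φ ++ [(.bot, compPre i ++ μ)] = Φ ++ exchange i μ [] from rfl] at hT hU
  have hsame := component_append_exchange i Φ μ
  have hother := component_not_append_exchange i Φ μ
  cases i
  · rw [Bool.not_false] at hother
    simp only [antecedent, consequent, hsame, hother, Position.neg, List.map_append] at hT hΦ ⊢
    exact h.left hΦ hT
  · rw [Bool.not_true] at hother
    simp only [antecedent, consequent, hsame, hother, Position.neg, List.map_append,
      List.map_map] at hU hΦ ⊢
    exact h.right hΦ hU

theorem IsInvariant.wins {Inv : K → Position → Position → Prop} (h : S.IsInvariant C D Inv)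
    (Step : K → K → Prop) (refl : ∀ d, Step d d) (step : ∀ i d μ, Step d (S.reply i d μ).1)
    (limit : ∀ (d : ℕ → K) (T U : ℕ → Position), (∀ n, Inv (d n) (T n) (U n)) →
      (∀ n, Step (d n) (d (n + 1))) → (∀ m n, m ≤ n → T m <+: T n) →
        (∀ m n, m ≤ n → U m <+: U n) → C.Wn (limitRun T) = .top → D.Wn (limitRun U) = .top) :
    S.toStrategy.toAgent.Wins (C.neg.or D) := by
  refine Strategy.wins_of_invariant (fun d Φ => (Φ : Run) ∈ (C.neg.or D).Lr ∧
    Inv d (antecedent Φ) (consequent Φ)) Step refl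
    ⟨(C.neg.or D).prefixDetermined.nil_mem, h.start⟩ And.left ?_ ?_
  · rintro d Φ m ⟨hΦ, hInv⟩ hm
    obtain ⟨i, μ, rfl : m = _⟩ := (mem_imp_Lr.1 hm).1 _ (List.mem_concat_self)
    have hnext := h.append_exchange hInv hm
    rw [append_respond]
    have e : (S.toStrategy.respond d (compPre i ++ μ)).1 = (S.reply i d μ).1 := by cases i <;> rfl
    rw [e]
    refine ⟨⟨mem_imp_Lr.2 ⟨?_, h.legal_left hnext, h.legal_right hnext⟩, hnext⟩, step i d μ⟩
    rw [List.forall_mem_append, exchange, List.forall_mem_cons, List.forall_mem_map]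
    exact ⟨(mem_imp_Lr.1 hΦ).1, ⟨i, μ, rfl⟩, fun m _ => ⟨!i, m, rfl⟩⟩
  · exact fun d P hInv hStep hP => wn_imp_limitRun hP (fun n => (hInv n).1) <|
      limit d _ _ (fun n => (hInv n).2) hStep (fun m n h => ((hP m n h).filterMap _).map _)
        fun m n h => (hP m n h).filterMap _

theorem computable_respond [Primcodable K] (hS : ∀ i, Computable₂ (S.reply i)) :
    Computable₂ S.toStrategy.respond := by
  have hi : Computable fun x : K × Move => decide (x.2.head? = some .two) :=
    ((Primrec.dom_finite fun c : Option Key => decide (c = some .two)).comp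
      (Primrec.list_head?.comp .snd)).to_comp
  have hr : Computable fun x : K × Move =>
      S.reply (decide (x.2.head? = some .two)) x.1 (x.2.drop 2) := by
    have hd : Computable fun x : K × Move => x.2.drop 2 :=
      (Primrec.list_drop.comp (.const 2) .snd).to_comp
    refine .of_eq (.cond hi ((hS true).comp .fst hd) ((hS false).comp .fst hd)) fun x => ?_
    cases decide (x.2.head? = some .two) <;> rfl
  have hp : Computable fun x : K × Move => compPre (!decide (x.2.head? = some .two)) :=
    (Primrec.dom_finite fun i => compPre (!i)).to_comp.comp hi
  have hmap : Primrec₂ fun (p : Move) (S : List Move) => S.map (p ++ ·) :=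
    .list_map .snd (Primrec.list_append.comp (Primrec.fst.comp .fst) .snd)
  exact .pair (.comp .fst hr) (hmap.to_comp.comp hp (.comp .snd hr))

end Imitation

end

/-! ### Threads and trees -/

section

theorem parseAddr_replMove (w : List Bool) : parseAddr (replMove w) = none := by
  induction w with
  | nil => rfl
  | cons b w ih => cases b <;> simpa [replMove, bits, bitKey, parseAddr] using ih

theorem addrMove_ne_replMove (w u : List Bool) (α : Move) : addrMove w α ≠ replMove u := fun h => by
  simpa [parseAddr_addrMove, parseAddr_replMove] using congrArg parseAddr h

theorem bitKey_injective : Function.Injective bitKey := by decide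

theorem replMove_injective : Function.Injective replMove := fun _ _ h =>
  List.map_injective_iff.2 bitKey_injective (List.append_cancel_right h)

/-- The part of a position in the thread `x`. -/
def thread (x : Bitstream) (Φ : Position) : Position := Φ.filterMap (threadMap x)

variable {A C D : Game} {T Φ Ψ : Position} {p : Player} {u w : List Bool} {x : Bitstream}
  {α : Move}

theorem thread_append : thread x (Φ ++ Ψ) = thread x Φ ++ thread x Ψ := List.filterMap_append

theorem thread_append_of_isPre (h : IsPre w x) :
    thread x (Φ ++ [(p, addrMove w α)]) = thread x Φ ++ [(p, α)] := by
  simp [thread, threadMap, parseAddr_addrMove, h]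

theorem thread_append_of_not_isPre (h : ¬ IsPre w x) :
    thread x (Φ ++ [(p, addrMove w α)]) = thread x Φ := by
  simp [thread, threadMap, parseAddr_addrMove, h]

theorem thread_append_replMove : thread x (Φ ++ [(p, replMove u)]) = thread x Φ := by
  simp [thread, threadMap, parseAddr_replMove]

theorem mem_cstL_Lr : (Φ : Run) ∈ A.cstL.Lr ↔
    (∀ a ∈ Φ, ∃ w α, a.2 = addrMove w α) ∧ ∀ x, (thread x Φ : Run) ∈ A.Lr := by
  change ((∀ a ∈ (Φ : Run), ∃ w α, a.2 = addrMove w α) ∧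
    ∀ x, Run.filterMap (threadMap x) (Φ : Run) ∈ A.Lr) ↔ _
  simp only [Run.filterMap_ofList]
  exact and_congr_left' (by simp [Stream'.Seq.mem_iff_exists_get?, List.mem_iff_getElem?, eq_comm])

theorem mem_cstT_Lr_append {a : Labmove} : ((Φ ++ [a] : Position) : Run) ∈ A.cstT.Lr ↔
    (Φ : Run) ∈ A.cstT.Lr ∧ OldLegalMove A Φ a := by
  change (∀ Ψ b, IsInitial (Ψ ++ [b]) ((Φ ++ [a] : Position) : Run) → OldLegalMove A Ψ b) ↔
    (∀ Ψ b, IsInitial (Ψ ++ [b]) (Φ : Run) → OldLegalMove A Ψ b) ∧ _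
  simp only [isInitial_ofList]
  constructor
  · exact fun h => ⟨fun Ψ b hb => h Ψ b (hb.trans (List.prefix_append _ _)), h _ _ List.prefix_rfl⟩
  · rintro ⟨hΦ, ha⟩ Ψ b hb
    rcases List.prefix_concat_iff.1 hb with h | h
    · obtain ⟨rfl, hab⟩ := List.append_inj' h rfl
      obtain rfl : b = a := List.singleton_inj.1 hab
      exact ha
    · exact hΦ Ψ b h

theorem thread_mem_of_mem_cstT (h : (Φ : Run) ∈ A.cstT.Lr) (x : Bitstream) :
    (thread x Φ : Run) ∈ A.Lr := by
  induction Φ using List.reverseRecOn with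
  | nil => exact A.prefixDetermined.nil_mem
  | append_singleton Φ a ih =>
    obtain ⟨hΦ, ha⟩ := mem_cstT_Lr_append.1 h
    obtain ⟨p, m⟩ := a
    rcases ha with ⟨-, w, -, rfl : m = _⟩ | ⟨w, α, rfl : m = _, -, hα⟩
    · rw [thread_append_replMove]
      exact ih hΦ
    · by_cases hx : IsPre w x
      · rw [thread_append_of_isPre hx]
        exact hα x hx
      · rw [thread_append_of_not_isPre hx]
        exact ih hΦ

/-- The game `C` is won if all essentially finite threads are won as runs of `A`, like both the old
and the new countable recurrence of `A`. -/
def IsCountableRecurrence (A C : Game) : Prop :=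
  ∀ Γ ∈ C.Lr, C.Wn Γ = .top ↔ ∀ x, EssFin x → A.Wn (Γ.thread x) = .top

theorem isCountableRecurrence_cstT (A : Game) : IsCountableRecurrence A A.cstT :=
  fun _ => Game.wn_ofLegal

theorem isCountableRecurrence_cstL (A : Game) : IsCountableRecurrence A A.cstL :=
  fun _ => Game.wn_ofLegal

theorem IsCountableRecurrence.wn_limitRun (hC : IsCountableRecurrence A C)
    (hD : IsCountableRecurrence A D) {T U : ℕ → Position} (hT : ∀ m n, m ≤ n → T m <+: T n)
    (hU : ∀ m n, m ≤ n → U m <+: U n) (hTC : ∀ n, (T n : Run) ∈ C.Lr)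
    (hUD : ∀ n, (U n : Run) ∈ D.Lr)
    (h : ∀ x, EssFin x → ∃ y, EssFin y ∧ ∀ n, thread y (T n) = thread x (U n))
    (hwin : C.Wn (limitRun T) = .top) : D.Wn (limitRun U) = .top := by
  rw [hC _ (limitRun_mem C.prefixDetermined hT hTC)] at hwin
  rw [hD _ (limitRun_mem D.prefixDetermined hU hUD)]
  intro x hx
  obtain ⟨y, hy, hyx⟩ := h x hx
  have hyT := hwin y hy
  rw [Run.thread, filterMap_limitRun hT] at hyT
  rw [Run.thread, filterMap_limitRun hU]
  exact funext hyx ▸ hyT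

theorem IsPre.of_prefix (h : u <+: w) (hw : IsPre w x) : IsPre u x := fun i hi => by
  rw [h.getElem hi]
  exact hw i _

theorem IsPre.prefix_of_length_le (hu : IsPre u x) (hw : IsPre w x) (h : u.length ≤ w.length) :
    u <+: w :=
  List.prefix_iff_getElem.2 ⟨h, fun i hi => (hu i hi).trans (hw i _).symm⟩

theorem exists_isPre (w : List Bool) : ∃ x, IsPre w x :=
  ⟨fun i => w.getD i false, fun i hi => by simp [hi]⟩

theorem isNode_append : IsNode (T ++ Φ) w ↔ IsNode T w ∨ IsNode Φ w := by
  constructor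
  · rintro (h | ⟨u, b, rfl, a, ha, h⟩)
    · exact .inl (.inl h)
    · exact (List.mem_append.1 ha).imp (fun ha => .inr ⟨u, b, rfl, a, ha, h⟩)
        fun ha => .inr ⟨u, b, rfl, a, ha, h⟩
  · rintro ((h | ⟨u, b, rfl, a, ha, h⟩) | (h | ⟨u, b, rfl, a, ha, h⟩))
    · exact .inl h
    · exact .inr ⟨u, b, rfl, a, List.mem_append_left _ ha, h⟩
    · exact .inl h
    · exact .inr ⟨u, b, rfl, a, List.mem_append_right _ ha, h⟩

theorem isNode_append_addrMove : IsNode (T ++ [(p, addrMove u α)]) w ↔ IsNode T w := by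
  rw [isNode_append, or_iff_left_iff_imp]
  rintro (h | ⟨v, b, -, a, ha, h⟩)
  · exact .inl h
  · obtain rfl := List.mem_singleton.1 ha
    exact absurd h (addrMove_ne_replMove u v α)

theorem isNode_append_replMove :
    IsNode (T ++ [(p, replMove u)]) w ↔ IsNode T w ∨ ∃ b, w = u ++ [b] := by
  rw [isNode_append]
  constructor
  · rintro (h | h | ⟨v, b, rfl, a, ha, h⟩)
    · exact .inl h
    · exact .inl (.inl h)
    · obtain rfl := List.mem_singleton.1 ha
      exact .inr ⟨b, replMove_injective h ▸ rfl⟩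
  · exact Or.imp_right fun ⟨b, h⟩ => .inr ⟨u, b, h, _, List.mem_singleton_self _, rfl⟩

end

/-! ### From the old recurrence to the new one -/

section

variable {A : Game} {T : Position} {S : List (List Bool)} {p : Player} {α : Move} {d : ℕ}

theorem isNode_append_map_replMove {w : List Bool} :
    IsNode (T ++ S.map fun u => (p, replMove u)) w ↔
      IsNode T w ∨ ∃ u ∈ S, ∃ b, w = u ++ [b] := by
  induction S using List.reverseRecOn with
  | nil => simp
  | append_singleton S u ih =>
    rw [List.map_append, ← List.append_assoc, List.map_singleton, isNode_append_replMove, ih]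
    simp only [List.mem_append, List.mem_singleton, or_and_right, exists_or, exists_eq_left,
      or_assoc]

theorem IsLeaf.append_replMove {u w : List Bool} (hu : IsLeaf T u) (hw : IsLeaf T w) (h : w ≠ u) :
    IsLeaf (T ++ [(p, replMove u)]) w := by
  refine ⟨isNode_append_replMove.2 (.inl hw.1), fun w' hw' hp => ?_⟩
  rcases isNode_append_replMove.1 hw' with hw' | ⟨b, rfl⟩
  · exact hw.2 w' hw' hp
  · exact (List.prefix_concat_iff.1 hp).elim Eq.symm fun hp => absurd (hw.2 u hu.1 hp).symm h

theorem append_map_replMove_mem_cstT (hT : (T : Run) ∈ A.cstT.Lr) (hS : S.Nodup)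
    (hl : ∀ u ∈ S, IsLeaf T u) :
    ((T ++ S.map fun u => (.bot, replMove u) : Position) : Run) ∈ A.cstT.Lr := by
  induction S generalizing T with
  | nil => simpa using hT
  | cons u S ih =>
    rw [List.nodup_cons] at hS
    rw [List.forall_mem_cons] at hl
    rw [List.map_cons, ← List.singleton_append, ← List.append_assoc]
    exact ih (mem_cstT_Lr_append.2 ⟨hT, .inl ⟨rfl, u, hl.1, rfl⟩⟩) hS.2 fun w hw =>
      hl.1.append_replMove (hl.2 w hw) (ne_of_mem_of_not_mem hw hS.1)

theorem thread_append_map_replMove {x : Bitstream} :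
    thread x (T ++ S.map fun u => (p, replMove u)) = thread x T := by
  simp [thread, List.filterMap_map, threadMap, parseAddr_replMove]

/-- The bitstrings of length `k`. -/
def bitstrings : ℕ → List (List Bool)
  | 0 => [[]]
  | k + 1 => (bitstrings k).flatMap fun w => [w ++ [false], w ++ [true]]

theorem mem_bitstrings {k : ℕ} {w : List Bool} : w ∈ bitstrings k ↔ w.length = k := by
  induction k generalizing w with
  | zero => simp [bitstrings]
  | succ k ih =>
    rcases List.eq_nil_or_concat' w with rfl | ⟨w, b, rfl⟩
    · simp [bitstrings]
    · cases b <;> simp [bitstrings, ih]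

theorem nodup_bitstrings (k : ℕ) : (bitstrings k).Nodup := by
  induction k with
  | zero => exact List.nodup_singleton _
  | succ k ih =>
    refine List.nodup_flatMap.2 ⟨by simp, ih.imp fun h => ?_⟩
    simpa [Function.onFun] using h.symm

/-- The nodes of the position `T` are the bitstrings of length at most `d`. -/
def IsComplete (T : Position) (d : ℕ) : Prop := ∀ w, IsNode T w ↔ w.length ≤ d

theorem IsComplete.isLeaf (h : IsComplete T d) {w : List Bool} (hw : w.length = d) :
    IsLeaf T w :=
  ⟨(h w).2 hw.le, fun w' hw' hp =>
    (hp.eq_of_length (le_antisymm hp.length_le (((h w').1 hw').trans_eq hw.symm))).symm⟩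

/-- The replication moves which turn a complete tree of depth `d` into one of depth `d + n`. -/
def growMoves (d n : ℕ) : List Move :=
  (List.range n).flatMap fun k => (bitstrings (d + k)).map replMove

theorem IsComplete.grow (h : IsComplete T d) (hT : (T : Run) ∈ A.cstT.Lr) (n : ℕ) :
    IsComplete (T ++ (growMoves d n).map (Prod.mk .bot)) (d + n) ∧
      ((T ++ (growMoves d n).map (Prod.mk .bot) : Position) : Run) ∈ A.cstT.Lr ∧
      ∀ x, thread x (T ++ (growMoves d n).map (Prod.mk .bot)) = thread x T := by
  induction n with
  | zero => simpa [growMoves] using ⟨h, hT⟩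
  | succ n ih =>
    obtain ⟨hc, hL, ht⟩ := ih
    have hgrow : T ++ (growMoves d (n + 1)).map (Prod.mk .bot) =
        (T ++ (growMoves d n).map (Prod.mk .bot)) ++
          (bitstrings (d + n)).map fun u => (.bot, replMove u) := by
      simp [growMoves, List.range_succ]
    rw [hgrow]
    refine ⟨fun w => ?_, append_map_replMove_mem_cstT hL (nodup_bitstrings _) fun u hu =>
      hc.isLeaf (mem_bitstrings.1 hu), fun x => thread_append_map_replMove.trans (ht x)⟩
    rw [isNode_append_map_replMove, hc w]
    constructor
    · rintro (hw | ⟨u, hu, b, rfl⟩)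
      · omega
      · rw [List.length_append, mem_bitstrings.1 hu, List.length_singleton, add_assoc]
    · intro hw
      refine (le_or_gt w.length (d + n)).imp_right fun hlt => ?_
      rcases List.eq_nil_or_concat' w with rfl | ⟨u, b, rfl⟩
      · simp at hlt
      · simp only [List.length_append, List.length_singleton] at hw hlt
        exact ⟨u, mem_bitstrings.2 (by omega), b, rfl⟩

/-- The imitation from the old recurrence to the new one. The antecedent is kept at a complete tree,
whose depth it remembers, and which grows until the address of the environment's move is a node. -/
def oldToNew : Imitation ℕ where
  start := 0
  reply
    | false, d, μ => (d, [μ])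
    | true, d, μ => (d + μ.length, growMoves d μ.length ++ [μ])

theorem isInvariant_oldToNew (A : Game) : oldToNew.IsInvariant A.cstT A.cstL fun d T U =>
    ((T : Run) ∈ A.cstT.Lr ∧ (U : Run) ∈ A.cstL.Lr) ∧ IsComplete T d ∧
      ∀ x, thread x T = thread x U where
  start := ⟨⟨A.cstT.prefixDetermined.nil_mem, A.cstL.prefixDetermined.nil_mem⟩,
    fun w => by simp [IsNode, oldToNew], fun _ => rfl⟩
  legal_left h := h.1.1
  legal_right h := h.1.2
  left {d T U μ} := by
    rintro ⟨⟨-, hU⟩, hd, ht⟩ hμ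
    rcases (mem_cstT_Lr_append.1 hμ).2 with ⟨⟨⟩, -⟩ | ⟨w, α, rfl : μ = _, -⟩
    have ht' (x) : thread x (T ++ [(.top, addrMove w α)]) =
        thread x (U ++ [(.top, addrMove w α)]) := by
      rw [thread_append, thread_append, ht]
    refine ⟨⟨hμ, mem_cstL_Lr.2 ⟨?_, fun x => ht' x ▸ thread_mem_of_mem_cstT hμ x⟩⟩,
      fun u => isNode_append_addrMove.trans (hd u), ht'⟩
    exact List.forall_mem_append.2
      ⟨(mem_cstL_Lr.1 hU).1, List.forall_mem_singleton.2 ⟨w, α, rfl⟩⟩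
  right {d T U μ} := by
    rintro ⟨⟨hT, -⟩, hd, ht⟩ hμ
    obtain ⟨w, α, rfl : μ = _⟩ := (mem_cstL_Lr.1 hμ).1 _ List.mem_concat_self
    obtain ⟨hc, hL, ht'⟩ := hd.grow hT (addrMove w α).length
    simp only [oldToNew, List.map_append, List.map_singleton, ← List.append_assoc]
    refine ⟨⟨mem_cstT_Lr_append.2 ⟨hL, .inr ⟨w, α, rfl, (hc w).2 ?_, fun x hx => ?_⟩⟩, hμ⟩,
      fun u => isNode_append_addrMove.trans (hc u), fun x => ?_⟩
    · simp only [addrMove, bits, List.length_append, List.length_map]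
      omega
    · have hx' := (mem_cstL_Lr.1 hμ).2 x
      rw [thread_append_of_isPre hx, ← ht, ← ht'] at hx'
      exact hx'
    · rw [thread_append (Ψ := [_]), thread_append (Ψ := [_]), ht', ht]

theorem primrec_bits : Primrec bits :=
  .list_map .id ((Primrec.dom_finite bitKey).comp .snd).to₂

theorem primrec_replMove : Primrec replMove :=
  Primrec.list_append.comp primrec_bits (.const [Key.colon])

theorem primrec_bitstrings : Primrec bitstrings := by
  have hstep : Primrec₂ fun (_ : ℕ) (L : List (List Bool)) =>
      L.flatMap fun w => [w ++ [false], w ++ [true]] :=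
    .list_flatMap .snd <| Primrec.list_cons.comp (Primrec.list_concat.comp .snd (.const false))
      (Primrec.list_cons.comp (Primrec.list_concat.comp .snd (.const true)) (.const []))
  exact (Primrec.nat_rec₁ [[]] hstep).of_eq fun n => by
    induction n with
    | zero => rfl
    | succ n ih => exact congrArg (List.flatMap _) ih

theorem primrec_growMoves : Primrec₂ growMoves :=
  .list_flatMap (.comp .list_range .snd) <| Primrec.to₂ <|
    .list_map (primrec_bitstrings.comp (Primrec.nat_add.comp (.comp .fst .fst) .snd))
      (primrec_replMove.comp .snd).to₂

theorem computable_oldToNew_reply : ∀ i, Computable₂ (oldToNew.reply i)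
  | false => (Primrec.pair .fst (Primrec.list_cons.comp .snd (.const []))).to_comp
  | true => (Primrec.pair (Primrec.nat_add.comp .fst (Primrec.list_length.comp .snd))
      (Primrec.list_concat.comp (primrec_growMoves.comp .fst (Primrec.list_length.comp .snd))
        .snd)).to_comp

theorem exists_wins_oldToNew : ∃ M : EPM, ∀ A : Game, M.Wins (A.cstT.neg.or A.cstL) := by
  obtain ⟨M, hM⟩ := Strategy.exists_wins (oldToNew.computable_respond computable_oldToNew_reply)
  refine ⟨M, fun A => hM _ ?_⟩
  exact (isInvariant_oldToNew A).wins (fun _ _ => True) (fun _ => trivial) (fun _ _ _ => trivial)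
    fun d T U h _ hT hU => (isCountableRecurrence_cstT A).wn_limitRun (isCountableRecurrence_cstL A)
      hT hU (fun n => (h n).1.1) (fun n => (h n).1.2) fun x hx => ⟨x, hx, fun n => (h n).2.2 x⟩

end

/-! ### Tables of matched leaves and addresses -/

section

section

variable {u u' w w' : List Bool} {x : Bitstream}

/-- Neither of two bitstrings is a prefix of the other. -/
def Incomp (u w : List Bool) : Prop := ¬ u <+: w ∧ ¬ w <+: u

theorem Incomp.symm (h : Incomp u w) : Incomp w u := And.symm h

theorem Incomp.not_isPre (h : Incomp u w) (hu : IsPre u x) : ¬ IsPre w x := fun hw =>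
  (le_total u.length w.length).elim (fun hl => h.1 (hu.prefix_of_length_le hw hl))
    fun hl => h.2 (hw.prefix_of_length_le hu hl)

theorem Incomp.of_prefix (h : Incomp u w) (hu : u <+: u') (hw : w <+: w') : Incomp u' w' := by
  constructor <;> intro hp
  · exact (List.prefix_or_prefix_of_prefix (hu.trans hp) hw).elim h.1 h.2
  · exact (List.prefix_or_prefix_of_prefix hu (hw.trans hp)).elim h.1 h.2

theorem incomp_concat (w : List Bool) : Incomp (w ++ [false]) (w ++ [true]) := by
  constructor <;> intro h <;> simpa using h.eq_of_length (by simp)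

theorem IsPre.concat (h : IsPre w x) : IsPre (w ++ [x w.length]) x := by
  intro i hi
  rw [List.getElem_append]
  split_ifs with hi'
  · exact h i hi'
  · rw [List.length_append, List.length_singleton] at hi
    obtain rfl : i = w.length := by omega
    rw [List.getElem_singleton]

/-- The bitstrings `f e`, for `e` in the list `E`, are pairwise incomparable. -/
def Separated {ι : Type*} (f : ι → List Bool) (E : List ι) : Prop :=
  E.Pairwise fun e e' => Incomp (f e) (f e')

theorem Separated.eq_of_isPre {ι : Type*} {f : ι → List Bool} {E : List ι} (h : Separated f E)
    {e e' : ι} (he : e ∈ E) (he' : e' ∈ E) (hx : IsPre (f e) x) (hx' : IsPre (f e') x) :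
    e = e' := by
  have : Std.Symm fun e e' : ι => Incomp (f e) (f e') := ⟨fun _ _ h => h.symm⟩
  by_contra hne
  exact (List.Pairwise.forall h he he' hne).not_isPre hx hx'

end

/-- A leaf of the tree of a position of the old recurrence, matched with an address in the new
recurrence. The address differs from the leaf by some zeros, whose places are marked with `none`. -/
abbrev Entry := List (Option Bool)

namespace Entry

variable {e e' : Entry} {u : List Bool}

/-- The leaf of an entry. -/
def leaf (e : Entry) : List Bool := e.filterMap id

/-- The address of an entry. -/
def addr (e : Entry) : List Bool := e.map fun x => x.getD false

/-- The entry `e`, with as many zeros added to its address as the move `μ` has letters. -/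
def pad (μ : Move) (e : Entry) : Entry := e ++ μ.map fun _ => none

/-- The entries into which `e` is split when the leaf `u` is replicated. -/
def split (u : List Bool) (e : Entry) : List Entry :=
  if e.leaf = u then [e ++ [some false], e ++ [some true]] else [e]

theorem leaf_prefix (h : e <+: e') : e.leaf <+: e'.leaf := h.filterMap id

theorem addr_prefix (h : e <+: e') : e.addr <+: e'.addr := h.map _

theorem leaf_concat (b : Bool) : leaf (e ++ [some b]) = e.leaf ++ [b] := by simp [leaf]

theorem addr_concat (b : Bool) : addr (e ++ [some b]) = e.addr ++ [b] := by simp [addr]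

theorem leaf_pad (μ : Move) : (e.pad μ).leaf = e.leaf := by simp [leaf, pad]

theorem length_le_length_addr_pad (μ : Move) : μ.length ≤ (e.pad μ).addr.length := by
  simp [addr, pad]

theorem prefix_pad (μ : Move) : e <+: e.pad μ := List.prefix_append _ _

theorem mem_split : e' ∈ e.split u ↔
    (e.leaf = u ∧ ∃ b, e' = e ++ [some b]) ∨ (e.leaf ≠ u ∧ e' = e) := by
  unfold split
  split_ifs with h <;> simp [h]

theorem prefix_of_mem_split (h : e' ∈ e.split u) : e <+: e' := by
  rcases mem_split.1 h with ⟨-, b, rfl⟩ | ⟨-, rfl⟩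
  · exact List.prefix_append _ _
  · exact List.prefix_rfl

theorem count_addr (e : Entry) : e.addr.count true = e.leaf.count true := by
  induction e with
  | nil => rfl
  | cons x e ih => rcases x with _ | _ | _ <;> simpa [addr, leaf, List.count_cons] using ih

end Entry

variable {A : Game} {T U : Position} {E E' : List Entry} {f g : Entry → List Bool}
  {u w : List Bool} {x : Bitstream} {p : Player} {α : Move}

theorem Separated.split (h : Separated g E) (hg : ∀ e b, g (e ++ [some b]) = g e ++ [b]) :
    Separated g (E.flatMap (Entry.split u)) := by
  have hpre {e e' : Entry} (he : e' ∈ e.split u) : g e <+: g e' := by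
    rcases Entry.mem_split.1 he with ⟨-, b, rfl⟩ | ⟨-, rfl⟩
    · exact hg e b ▸ List.prefix_append _ _
    · exact List.prefix_rfl
  refine List.pairwise_flatMap.2 ⟨fun e _ => ?_, h.imp ?_⟩
  · unfold Entry.split
    split_ifs
    · refine List.pairwise_pair.2 ?_
      rw [hg, hg]
      exact incomp_concat _
    · exact List.pairwise_singleton _ _
  · exact fun h _ ha _ hb => h.of_prefix (hpre ha) (hpre hb)

/-- The leaves of the table `E` are those of the tree of the position `U`. -/
structure IsLeafTable (U : Position) (E : List Entry) : Prop where
  isNode_iff : ∀ w, IsNode U w ↔ ∃ e ∈ E, w <+: e.leaf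
  separated : Separated Entry.leaf E
  cover : ∀ x, ∃ e ∈ E, IsPre e.leaf x

theorem isLeafTable_nil : IsLeafTable [] [[]] where
  isNode_iff w := by simp [IsNode, Entry.leaf]
  separated := List.pairwise_singleton _ _
  cover _ := ⟨[], List.mem_singleton_self _, fun _ hi => absurd hi (Nat.not_lt_zero _)⟩

theorem IsLeafTable.congr (h : IsLeafTable T E) (hTU : ∀ w, IsNode U w ↔ IsNode T w) :
    IsLeafTable U E where
  isNode_iff w := (hTU w).trans (h.isNode_iff w)
  separated := h.separated
  cover := h.cover

theorem IsLeafTable.pad (h : IsLeafTable U E) (μ : Move) : IsLeafTable U (E.map (Entry.pad μ)) where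
  isNode_iff w := by simp [h.isNode_iff, Entry.leaf_pad]
  separated := List.pairwise_map.2 <| h.separated.imp <| by
    simp only [Entry.leaf_pad, imp_self, implies_true]
  cover x := by simpa [Entry.leaf_pad] using h.cover x

theorem IsLeafTable.exists_of_isLeaf (h : IsLeafTable U E) (hu : IsLeaf U u) :
    ∃ e ∈ E, e.leaf = u := by
  obtain ⟨e, he, hp⟩ := (h.isNode_iff u).1 hu.1
  exact ⟨e, he, hu.2 _ ((h.isNode_iff _).2 ⟨e, he, List.prefix_rfl⟩) hp⟩

theorem IsLeafTable.split (h : IsLeafTable U E) (hu : IsLeaf U u) :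
    IsLeafTable (U ++ [(p, replMove u)]) (E.flatMap (Entry.split u)) where
  isNode_iff w := by
    simp only [isNode_append_replMove, h.isNode_iff, List.mem_flatMap, Entry.mem_split]
    constructor
    · rintro (⟨e, he, hw⟩ | ⟨b, rfl⟩)
      · by_cases hl : e.leaf = u
        · exact ⟨_, ⟨e, he, .inl ⟨hl, false, rfl⟩⟩,
            hw.trans (Entry.leaf_prefix (List.prefix_append _ _))⟩
        · exact ⟨e, ⟨e, he, .inr ⟨hl, rfl⟩⟩, hw⟩
      · obtain ⟨e, he, rfl⟩ := h.exists_of_isLeaf hu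
        exact ⟨_, ⟨e, he, .inl ⟨rfl, b, rfl⟩⟩, (Entry.leaf_concat b).symm ▸ List.prefix_rfl⟩
    · rintro ⟨_, ⟨e, he, ⟨rfl, b, rfl⟩ | ⟨-, rfl⟩⟩, hw⟩
      · rw [Entry.leaf_concat, List.prefix_concat_iff] at hw
        exact hw.symm.imp (fun hw => ⟨e, he, hw⟩) fun hw => ⟨b, hw⟩
      · exact .inl ⟨_, he, hw⟩
  separated := h.separated.split fun _ => Entry.leaf_concat
  cover x := by
    obtain ⟨e, he, hx⟩ := h.cover x
    by_cases hl : e.leaf = u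
    · exact ⟨_, List.mem_flatMap.2 ⟨e, he, Entry.mem_split.2 (.inl ⟨hl, x e.leaf.length, rfl⟩)⟩,
        (Entry.leaf_concat _).symm ▸ hx.concat⟩
    · exact ⟨e, List.mem_flatMap.2 ⟨e, he, Entry.mem_split.2 (.inr ⟨hl, rfl⟩)⟩, hx⟩

/-- For each entry `e` of the table `E`, the threads of `T` through `f e` equal those of `U` through
`g e`. -/
def Sync (E : List Entry) (f g : Entry → List Bool) (T U : Position) : Prop :=
  ∀ e ∈ E, ∀ v x, IsPre (f e) v → IsPre (g e) x → thread v T = thread x U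

theorem Sync.symm (h : Sync E f g T U) : Sync E g f U T :=
  fun e he v x hv hx => (h e he x v hx hv).symm

/-- Each entry of `E'` extends one of `E`. -/
def Extends (E E' : List Entry) : Prop := ∀ e' ∈ E', ∃ e ∈ E, e <+: e'

theorem extends_rfl : Extends E E := fun e he => ⟨e, he, List.prefix_rfl⟩

theorem extends_pad (μ : Move) : Extends E (E.map (Entry.pad μ)) :=
  List.forall_mem_map.2 fun e he => ⟨e, he, Entry.prefix_pad μ⟩

theorem extends_split : Extends E (E.flatMap (Entry.split u)) := fun _ he' =>
  let ⟨e, he, h⟩ := List.mem_flatMap.1 he'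
  ⟨e, he, Entry.prefix_of_mem_split h⟩

theorem Sync.extend (h : Sync E Entry.addr Entry.leaf T U) (hE : Extends E E') :
    Sync E' Entry.addr Entry.leaf T U := fun e' he' v x hv hx =>
  let ⟨e, he, hp⟩ := hE e' he'
  h e he v x (hv.of_prefix (Entry.addr_prefix hp)) (hx.of_prefix (Entry.leaf_prefix hp))

/-- Whether a letter is a bit. -/
def isBit : Key → Bool
  | .zero | .one => true
  | _ => false

/-- The longest bitstring with which a move begins. -/
def address (μ : Move) : List Bool := (μ.takeWhile isBit).map (· == .one)

/-- What follows the address of a move. -/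
def suffix (μ : Move) : Move := μ.dropWhile isBit

theorem isBit_of_mem_bits {k : Key} (h : k ∈ bits w) : isBit k = true := by
  obtain ⟨b, -, rfl⟩ := List.mem_map.1 h
  cases b <;> rfl

theorem address_bits_append {k : Key} (hk : isBit k = false) :
    address (bits w ++ k :: α) = w := by
  rw [address, List.takeWhile_append_of_pos fun _ => isBit_of_mem_bits, List.takeWhile_cons, hk]
  induction w with
  | nil => rfl
  | cons b w ih => cases b <;> simpa [bits, bitKey] using ih

theorem suffix_bits_append {k : Key} (hk : isBit k = false) :
    suffix (bits w ++ k :: α) = k :: α := by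
  rw [suffix, List.dropWhile_append_of_pos fun _ => isBit_of_mem_bits, List.dropWhile_cons, hk]
  rfl

/-- The move `μ`, readdressed from `f e` to `g e` for all entries `e` with `f e` below its
address. -/
def relay (E : List Entry) (f g : Entry → List Bool) (μ : Move) : List Move :=
  E.filterMap fun e => if address μ <+: f e then some (bits (g e) ++ suffix μ) else none

theorem relay_addrMove : relay E f g (addrMove w α) =
    (E.filter fun e => w <+: f e).map fun e => addrMove (g e) α := by
  unfold relay addrMove
  rw [address_bits_append rfl, suffix_bits_append rfl]
  induction E with
  | nil => rfl
  | cons e E ih => by_cases h : w <+: f e <;> simp [h, ih]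

theorem thread_relay_of_forall (h : ∀ e ∈ E, w <+: f e → ¬ IsPre (g e) x) :
    thread x ((relay E f g (addrMove w α)).map (Prod.mk p)) = [] := by
  rw [relay_addrMove, thread, List.filterMap_map, List.filterMap_map, List.filterMap_eq_nil_iff]
  intro e he
  rw [List.mem_filter, decide_eq_true_eq] at he
  simp [threadMap, parseAddr_addrMove, h e he.1 he.2]

theorem thread_relay_of_prefix (hE : Separated g E) {e : Entry} (he : e ∈ E) (hx : IsPre (g e) x)
    (hw : w <+: f e) : thread x ((relay E f g (addrMove w α)).map (Prod.mk p)) = [(p, α)] := by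
  have hother {E' : List Entry} (hE' : ∀ e' ∈ E', Incomp (g e) (g e')) :
      thread x ((relay E' f g (addrMove w α)).map (Prod.mk p)) = [] :=
    thread_relay_of_forall fun e' he' _ => (hE' e' he').not_isPre hx
  obtain ⟨E₁, E₂, rfl⟩ := List.append_of_mem he
  obtain ⟨-, hE₂, hE₁⟩ := List.pairwise_append.1 hE
  have hrelay : relay (E₁ ++ e :: E₂) f g (addrMove w α) =
      relay E₁ f g (addrMove w α) ++ [addrMove (g e) α] ++ relay E₂ f g (addrMove w α) := by
    simp [relay_addrMove, hw]
  rw [hrelay, List.map_append, List.map_append, List.map_singleton, thread_append,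
    thread_append_of_isPre hx, hother (List.pairwise_cons.1 hE₂).1,
    hother fun e' he' => (hE₁ e' he' e List.mem_cons_self).symm]
  rfl

theorem Sync.relay (h : Sync E f g T U) (hg : Separated g E)
    (hf : ∀ e ∈ E, ∀ v, IsPre (f e) v → IsPre w v → w <+: f e) :
    Sync E f g (T ++ [(p, addrMove w α)])
      (U ++ (relay E f g (addrMove w α)).map (Prod.mk p)) := by
  intro e he v x hv hx
  rw [thread_append (Φ := U), ← h e he v x hv hx]
  by_cases hw : w <+: f e
  · rw [thread_append_of_isPre (hv.of_prefix hw), thread_relay_of_prefix hg he hx hw]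
  · rw [thread_append_of_not_isPre fun h => hw (hf e he v hv h), thread_relay_of_forall,
      List.append_nil]
    intro e' he' hw' hx'
    exact hw (hg.eq_of_isPre he he' hx hx' ▸ hw')

theorem append_relay_mem_cstT (hU : (U : Run) ∈ A.cstT.Lr) (hE : Separated g E)
    (hnode : ∀ e ∈ E, IsNode U (g e)) (hlegal : ∀ e ∈ E, w <+: f e → ∀ x, IsPre (g e) x →
      ((thread x U ++ [(p, α)] : Position) : Run) ∈ A.Lr) :
    ((U ++ (relay E f g (addrMove w α)).map (Prod.mk p) : Position) : Run) ∈ A.cstT.Lr := by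
  induction E using List.reverseRecOn with
  | nil => simpa [relay] using hU
  | append_singleton E e ih =>
    obtain ⟨hE, -, hEe⟩ := List.pairwise_append.1 hE
    have hmem := ih hE (fun e he => hnode e (List.mem_append_left _ he)) fun e he =>
      hlegal e (List.mem_append_left _ he)
    by_cases hw : w <+: f e
    · have hrelay : relay (E ++ [e]) f g (addrMove w α) =
          relay E f g (addrMove w α) ++ [addrMove (g e) α] := by
        simp [relay_addrMove, hw]
      rw [hrelay, List.map_append, List.map_singleton, ← List.append_assoc]
      refine mem_cstT_Lr_append.2 ⟨hmem, .inr ⟨_, α, rfl,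
        isNode_append.2 (.inl (hnode e List.mem_concat_self)), fun x hx => ?_⟩⟩
      have hthread : thread x (U ++ (relay E f g (addrMove w α)).map (Prod.mk p)) = thread x U := by
        rw [thread_append, thread_relay_of_forall, List.append_nil]
        exact fun e' he' _ => (hEe e' he' e (List.mem_singleton_self _)).symm.not_isPre hx
      have hx' := hlegal e List.mem_concat_self hw x hx
      rwa [← hthread] at hx'
    · have hrelay : relay (E ++ [e]) f g (addrMove w α) = relay E f g (addrMove w α) := by
        simp [relay_addrMove, hw]
      rwa [hrelay]

theorem append_relay_mem_cstL (hU : (U : Run) ∈ A.cstL.Lr) (hlegal : ∀ e ∈ E, ∀ x,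
      IsPre (g e) x → (thread x (U ++ (relay E f g (addrMove w α)).map (Prod.mk p)) : Run) ∈ A.Lr) :
    ((U ++ (relay E f g (addrMove w α)).map (Prod.mk p) : Position) : Run) ∈ A.cstL.Lr := by
  obtain ⟨haddr, hthread⟩ := mem_cstL_Lr.1 hU
  refine mem_cstL_Lr.2 ⟨List.forall_mem_append.2 ⟨haddr, ?_⟩, fun x => ?_⟩
  · rw [relay_addrMove, List.forall_mem_map, List.forall_mem_map]
    exact fun e _ => ⟨g e, α, rfl⟩
  · by_cases hx : ∃ e ∈ E, IsPre (g e) x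
    · obtain ⟨e, he, hx⟩ := hx
      exact hlegal e he x hx
    · rw [thread_append, thread_relay_of_forall fun e he _ h => hx ⟨e, he, h⟩, List.append_nil]
      exact hthread x

theorem isNode_append_relay :
    IsNode (U ++ (relay E f g (addrMove w α)).map (Prod.mk p)) u ↔ IsNode U u := by
  rw [isNode_append, or_iff_left_iff_imp]
  rintro (rfl | ⟨v, b, -, a, ha, h⟩)
  · exact .inl rfl
  · simp only [relay_addrMove, List.mem_map] at ha
    obtain ⟨_, ⟨e, -, rfl⟩, rfl⟩ := ha
    exact absurd h (addrMove_ne_replMove _ _ _)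

end

/-! ### From the new recurrence to the old one -/

section

variable {A : Game} {T U : Position} {E E' : List Entry} {u w : List Bool} {x : Bitstream}
  {α μ : Move}

/-- The imitation from the new recurrence to the old one. It remembers a table of the leaves of the
tree of the consequent and of the addresses matched with them. A move in the antecedent comes with
an arbitrary address, and the addresses in the table are first padded to decide whether they extend
it; a replication in the consequent splits an entry of the table. -/
def newToOld : Imitation (List Entry) where
  start := [[]]
  reply
    | false, E, μ =>
      (E.map (Entry.pad μ), relay (E.map (Entry.pad μ)) Entry.addr Entry.leaf μ)
    | true, E, μ =>
      if suffix μ = [.colon] then (E.flatMap (Entry.split (address μ)), [])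
      else (E, relay E Entry.leaf Entry.addr μ)

theorem newToOld_reply_replMove :
    newToOld.reply true E (replMove u) = (E.flatMap (Entry.split u), []) := by
  simp only [newToOld, replMove, address_bits_append (k := .colon) rfl,
    suffix_bits_append (k := .colon) rfl, if_true]

theorem newToOld_reply_addrMove :
    newToOld.reply true E (addrMove w α) = (E, relay E Entry.leaf Entry.addr (addrMove w α)) := by
  have hsuffix : suffix (addrMove w α) ≠ [.colon] := by
    rw [addrMove, suffix_bits_append rfl]
    simp
  simp only [newToOld, if_neg hsuffix]

theorem extends_newToOld_reply (i : Bool) : Extends E (newToOld.reply i E μ).1 := by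
  cases i
  · exact extends_pad μ
  · by_cases h : suffix μ = [.colon]
    · simpa only [newToOld, if_pos h] using extends_split
    · simpa only [newToOld, if_neg h] using extends_rfl

/-- The leaves of the tree of `U` are matched with incomparable addresses in `T`, and matched
threads are equal. -/
structure IsMatched (E : List Entry) (T U : Position) : Prop where
  isLeafTable : IsLeafTable U E
  separated : Separated Entry.addr E
  sync : Sync E Entry.addr Entry.leaf T U

theorem IsMatched.pad (h : IsMatched E T U) (μ : Move) : IsMatched (E.map (Entry.pad μ)) T U where
  isLeafTable := h.isLeafTable.pad μ
  separated := List.pairwise_map.2 <| h.separated.imp fun h =>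
    h.of_prefix (Entry.addr_prefix (Entry.prefix_pad μ)) (Entry.addr_prefix (Entry.prefix_pad μ))
  sync := h.sync.extend (extends_pad μ)

theorem IsMatched.split (h : IsMatched E T U) (hu : IsLeaf U u) :
    IsMatched (E.flatMap (Entry.split u)) T (U ++ [(.bot, replMove u)]) where
  isLeafTable := h.isLeafTable.split hu
  separated := h.separated.split fun _ => Entry.addr_concat
  sync e he v x hv hx :=
    (h.sync.extend extends_split e he v x hv hx).trans thread_append_replMove.symm

theorem IsMatched.relay_addr (h : IsMatched E T U) (hw : ∀ e ∈ E, w.length ≤ e.addr.length) :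
    IsMatched E (T ++ [(.top, addrMove w α)])
      (U ++ (relay E Entry.addr Entry.leaf (addrMove w α)).map (Prod.mk .top)) where
  isLeafTable := h.isLeafTable.congr fun _ => isNode_append_relay
  separated := h.separated
  sync := h.sync.relay h.isLeafTable.separated fun e he _ hv hwv =>
    hwv.prefix_of_length_le hv (hw e he)

theorem IsLeafTable.prefix_leaf (h : IsLeafTable U E) (hu : IsNode U u) {e : Entry} (he : e ∈ E)
    (hx : IsPre e.leaf x) (hux : IsPre u x) : u <+: e.leaf := by
  refine (le_total u.length e.leaf.length).elim (hux.prefix_of_length_le hx) fun hl => ?_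
  have hp := hx.prefix_of_length_le hux hl
  obtain ⟨e', he', hu'⟩ := (h.isNode_iff u).1 hu
  obtain ⟨y, hy⟩ := exists_isPre e'.leaf
  exact h.separated.eq_of_isPre he he' (hy.of_prefix (hp.trans hu')) hy ▸ hu'

theorem IsMatched.relay_leaf (h : IsMatched E T U) (hu : IsNode U u) :
    IsMatched E (T ++ (relay E Entry.leaf Entry.addr (addrMove u α)).map (Prod.mk .bot))
      (U ++ [(.bot, addrMove u α)]) where
  isLeafTable := h.isLeafTable.congr fun _ => isNode_append_addrMove
  separated := h.separated
  sync := (h.sync.symm.relay h.separated fun _ he _ hv huv =>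
    h.isLeafTable.prefix_leaf hu he hv huv).symm

theorem isInvariant_newToOld (A : Game) : newToOld.IsInvariant A.cstL A.cstT fun E T U =>
    ((T : Run) ∈ A.cstL.Lr ∧ (U : Run) ∈ A.cstT.Lr) ∧ IsMatched E T U where
  start := ⟨⟨A.cstL.prefixDetermined.nil_mem, A.cstT.prefixDetermined.nil_mem⟩,
    isLeafTable_nil, List.pairwise_singleton _ _, fun _ _ _ _ _ _ => rfl⟩
  legal_left h := h.1.1
  legal_right h := h.1.2
  left {E T U μ} := by
    rintro ⟨⟨-, hU⟩, hE⟩ hμ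
    obtain ⟨w, α, rfl : μ = _⟩ := (mem_cstL_Lr.1 hμ).1 _ List.mem_concat_self
    have hpad := hE.pad (addrMove w α)
    refine ⟨⟨hμ, append_relay_mem_cstT hU hpad.isLeafTable.separated (fun e he =>
      (hpad.isLeafTable.isNode_iff _).2 ⟨e, he, List.prefix_rfl⟩) fun e he hw x hx => ?_⟩,
      hpad.relay_addr <| List.forall_mem_map.2 fun e _ =>
        le_trans (by simp [addrMove, bits]) (Entry.length_le_length_addr_pad _)⟩
    obtain ⟨v, hv⟩ := exists_isPre e.addr
    have hv' := (mem_cstL_Lr.1 hμ).2 v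
    rwa [thread_append_of_isPre (hv.of_prefix hw), hpad.sync e he v x hv hx] at hv'
  right {E T U μ} := by
    rintro ⟨⟨hT, -⟩, hE⟩ hμ
    rcases (mem_cstT_Lr_append.1 hμ).2 with ⟨-, u, hu, rfl : μ = _⟩ | ⟨u, α, rfl : μ = _, hu, -⟩
    · rw [newToOld_reply_replMove, List.map_nil, List.append_nil]
      exact ⟨⟨hT, hμ⟩, hE.split hu⟩
    · rw [newToOld_reply_addrMove]
      have hE' := hE.relay_leaf (α := α) hu
      refine ⟨⟨append_relay_mem_cstL hT fun e he x hx => ?_, hμ⟩, hE'⟩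
      obtain ⟨v, hv⟩ := exists_isPre e.leaf
      exact hE'.sync e he x v hx hv ▸ thread_mem_of_mem_cstT hμ v

theorem EssFin.exists_count_le (hx : EssFin x) :
    ∃ K, ∀ w, IsPre w x → w.count true ≤ K := by
  obtain ⟨K, hK⟩ := hx.bddAbove
  refine ⟨K + 1, fun w hw => ?_⟩
  have hdrop : true ∉ w.drop (K + 1) := fun h => by
    obtain ⟨i, hi, h⟩ := List.getElem_of_mem h
    rw [List.getElem_drop, hw] at h
    have := hK h
    omega
  rw [← List.take_append_drop (K + 1) w, List.count_append, List.count_eq_zero.2 hdrop, add_zero]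
  exact List.count_le_length.trans (List.length_take_le _ _)

theorem exists_forall_isPre {a : ℕ → List Bool} (ha : ∀ m n, m ≤ n → a m <+: a n) :
    ∃ x, (∀ n, IsPre (a n) x) ∧ ∀ i, x i = true → ∃ n, ∃ h : i < (a n).length, (a n)[i] = true := by
  classical
  have hget {m n i : ℕ} (hm : i < (a m).length) (hn : i < (a n).length) : (a m)[i] = (a n)[i] := by
    rcases le_total m n with h | h
    · exact (ha m n h).getElem hm
    · exact ((ha n m h).getElem hn).symm
  refine ⟨fun i => decide (∃ n, ∃ h : i < (a n).length, (a n)[i] = true), fun n i hi => ?_,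
    fun i => of_decide_eq_true⟩
  rw [Bool.eq_iff_iff, decide_eq_true_iff]
  exact ⟨fun h => ⟨n, hi, h⟩, fun ⟨m, hm, h⟩ => (hget hi hm).trans h⟩

theorem exists_essFin {a : ℕ → List Bool} (ha : ∀ m n, m ≤ n → a m <+: a n) {K : ℕ}
    (hK : ∀ n, (a n).count true ≤ K) : ∃ x, EssFin x ∧ ∀ n, IsPre (a n) x := by
  obtain ⟨x, hx, hxa⟩ := exists_forall_isPre ha
  refine ⟨x, ?_, hx⟩
  have hb : BddAbove (Set.range fun n => (a n).count true) := ⟨K, Set.forall_mem_range.2 hK⟩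
  obtain ⟨N, hN⟩ := Nat.sSup_mem (Set.range_nonempty fun n => (a n).count true) hb
  refine (Set.finite_lt_nat (a N).length).subset fun i hi => ?_
  obtain ⟨n, hn, ht⟩ := hxa i hi
  by_contra hc
  obtain ⟨r, hr⟩ := ha N (max n N) (le_max_right _ _)
  have hpre : a n <+: a N ++ r := hr ▸ ha n _ (le_max_left _ _)
  have hmem : true ∈ r := by
    rw [hpre.getElem hn, List.getElem_append_right (not_lt.1 hc)] at ht
    exact ht ▸ List.getElem_mem _
  have hcount : (a (max n N)).count true ≤ (a N).count true :=
    (le_csSup hb ⟨max n N, rfl⟩).trans_eq hN.symm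
  rw [← hr, List.count_append] at hcount
  have := List.count_pos_iff.2 hmem
  omega

theorem exists_essFin_thread {E : ℕ → List Entry} {T U : ℕ → Position}
    (h : ∀ n, IsMatched (E n) (T n) (U n)) (hE : ∀ n, Extends (E n) (E (n + 1))) (hx : EssFin x) :
    ∃ y, EssFin y ∧ ∀ n, thread y (T n) = thread x (U n) := by
  choose e he hex using fun n => (h n).isLeafTable.cover x
  have hstep (n) : e n <+: e (n + 1) := by
    obtain ⟨a, ha, hp⟩ := hE n _ (he (n + 1))
    rwa [(h n).isLeafTable.separated.eq_of_isPre (he n) ha (hex n)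
      ((hex (n + 1)).of_prefix (Entry.leaf_prefix hp))]
  have hmono (m n) (hmn : m ≤ n) : e m <+: e n :=
    Nat.le_induction List.prefix_rfl (fun n _ ih => ih.trans (hstep n)) n hmn
  obtain ⟨K, hK⟩ := hx.exists_count_le
  obtain ⟨y, hy, hye⟩ := exists_essFin (fun m n hmn => Entry.addr_prefix (hmono m n hmn))
    fun n => (e n).count_addr.trans_le (hK _ (hex n))
  exact ⟨y, hy, fun n => (h n).sync (e n) (he n) y x (hye n) (hex n)⟩

theorem primrec_prefix : PrimrecRel fun u w : List Bool => u <+: w :=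
  (Primrec.eq.comp .fst (Primrec.list_take.comp (Primrec.list_length.comp .fst) .snd)).of_eq
    fun _ => List.prefix_iff_eq_take.symm

theorem primrec_address : Primrec address :=
  .list_map (.list_takeWhile (.dom_finite isBit))
    ((Primrec.dom_finite (· == Key.one)).comp .snd).to₂

theorem primrec_suffix : Primrec suffix := .list_dropWhile (.dom_finite isBit)

theorem primrec_leaf : Primrec Entry.leaf := .listFilterMap .id .snd

theorem primrec_addr : Primrec Entry.addr :=
  .list_map .id ((Primrec.dom_finite fun x : Option Bool => x.getD false).comp .snd).to₂

theorem primrec_relay {f g : Entry → List Bool} (hf : Primrec f) (hg : Primrec g) :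
    Primrec₂ fun E μ => relay E f g μ :=
  .listFilterMap .fst <| Primrec.to₂ <|
    .ite (primrec_prefix.comp (primrec_address.comp (.comp .snd .fst)) (hf.comp .snd))
      (Primrec.option_some.comp (Primrec.list_append.comp (primrec_bits.comp (hg.comp .snd))
        (primrec_suffix.comp (.comp .snd .fst)))) (.const none)

theorem primrec_split : Primrec₂ Entry.split :=
  .ite (Primrec.eq.comp (primrec_leaf.comp .snd) .fst)
    (Primrec.list_cons.comp (Primrec.list_concat.comp .snd (.const (some false)))
      (Primrec.list_cons.comp (Primrec.list_concat.comp .snd (.const (some true))) (.const [])))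
    (Primrec.list_cons.comp .snd (.const []))

theorem primrec_map_pad : Primrec₂ fun (E : List Entry) μ => E.map (Entry.pad μ) :=
  .list_map .fst <| Primrec.list_append.comp .snd <|
    .list_map (.comp .snd .fst) (.const none)

theorem computable_newToOld_reply : ∀ i, Computable₂ (newToOld.reply i)
  | false => (Primrec.pair primrec_map_pad
      ((primrec_relay primrec_addr primrec_leaf).comp primrec_map_pad .snd)).to_comp
  | true => (Primrec.ite (Primrec.eq.comp (primrec_suffix.comp .snd) (.const [Key.colon]))
      (Primrec.pair (.list_flatMap .fst (primrec_split.comp (primrec_address.comp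
        (.comp .snd .fst)) .snd).to₂) (.const []))
      (Primrec.pair .fst (primrec_relay primrec_leaf primrec_addr))).to_comp

theorem exists_wins_newToOld : ∃ M : EPM, ∀ A : Game, M.Wins (A.cstL.neg.or A.cstT) := by
  obtain ⟨M, hM⟩ := Strategy.exists_wins (newToOld.computable_respond computable_newToOld_reply)
  refine ⟨M, fun A => hM _ ?_⟩
  exact (isInvariant_newToOld A).wins Extends (fun _ => extends_rfl)
    (fun i _ _ => extends_newToOld_reply i)
    fun E T U h hE hT hU => (isCountableRecurrence_cstL A).wn_limitRun
      (isCountableRecurrence_cstT A) hT hU (fun n => (h n).1.1) (fun n => (h n).1.2) fun x hx =>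
        exists_essFin_thread (fun n => (h n).2) hE hx

end

end CoL

end

theorem theorem3p4_general :
    (∃ M : CoL.EPM, ∀ A : CoL.Game, M.Wins (A.cstT.neg.or A.cstL)) ∧
      ∃ M : CoL.EPM, ∀ A : CoL.Game, M.Wins (A.cstL.neg.or A.cstT) :=
  ⟨CoL.exists_wins_oldToNew, CoL.exists_wins_newToOld⟩

theorem theorem3p4 {Atom : Type*} (F : CoL.Formula Atom) :
    (CoL.Formula.imp (.cstT F) (.cstL F)).UniformlyValid ∧
      (CoL.Formula.imp (.cstL F) (.cstT F)).UniformlyValid :=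
  theorem3p4_general.imp (.imp fun _ hM I _ => F.cstT.interp_imp I F.cstL ▸ hM (F.interp I))
    (.imp fun _ hM I _ => F.cstL.interp_imp I F.cstT ▸ hM (F.interp I))
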